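/- **Terms.** The terms of the $\lambda\mu$-calculus are built from $\lambda$-variables $x,y,\dots$ and $\mu$-variables $\alpha,\beta,\dots$ by $t ::= x \mid \lambda x\,t \mid (t)t \mid \mu\alpha[\beta]t$, up to renaming of bound variables; $[\beta]t$ is called a named term. A term is closed if it has no free variable of either kind. Write $u[v/{*}\alpha]$ for the result of replacing inductively in $u$ every subterm $[\alpha]w$ by $[\alpha](w)v$. One step of reduction contracts, at any place of a term, a redex of one of the rules - $(C_1)$ $(\lambda x\,u)v\to u[v/x]$; - $(C_2)$ $(\mu\alpha\,u)v\to\mu\alpha\,u[v/{*}\alpha]$; - $(S_1)$ $[\alpha]\mu\beta\,u\to u[\alpha/\beta]$; - $(S_2)$ $\mu\alpha[\alpha]u\to u$ if $\alpha$ is not free in $u$; - $(S_3)$ $\mu\alpha\,u\to\lambda x\,\mu\alpha\,u[x/{*}\alpha]$ ($x$ fresh) if $u$ contains a subterm of the form $[\alpha]\lambda y\,w$. Write $t\to t'$ if $t$ reduces to $t'$ in finitely many (possibly zero) steps; $t$ is normal if it contains no redex. Head normal forms are given inductively: variables; $\lambda x\,u$ with $u$ a head normal form; $(u)v$ with $u$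 a head normal form and $(u)v$ not a redex; $\mu\alpha[\beta]u$ with $u$ a head normal form and neither $\mu\alpha[\beta]u$ nor $[\beta]u$ a redex. Write $t\succ t'$ if $t'$ is obtained from $t$ by a finite (possibly empty) sequence of steps, each of which starts from a term that is not a head normal form and contracts its leftmost redex. **Types.** Fix a language with a constant $0$, a unary function symbol $s$ and possibly other symbols. Types are the formulas built from atomic formulas (with relation variables of all arities) by $\perp,\to$ and first and second order $\forall$. Let $E$ be a set of (universally quantified) equations that is adequate for the integers: for all individual terms $a,b$, $E\not\vdash s(a)=0$, and if $E\vdash s(a)=s(b)$ then $E\vdash a=b$. The judgments $\Gamma\vdash t:A,\Delta$, where the formulas of $\Gamma$ are labelled by distinct $\lambda$-variables and those of $\Delta$ by distinct $\mu$-variables, are derived by the rules: - $\Gamma\vdash x:A,\Delta$ if $x:A$ is in $\Gamma$; - from $\Gamma,x:A\vdash t:B,\Delta$ infer $\Gamma\vdash\lambda x\,t:A\to B,\Delta$; - from $\Gamma\vdash u:A\to B,\Delta$ and $\Gamma\vdash v:A,\Delta$ infer $\Gamma\vdash(u)v:B,\Delta$; - from $\Gamma\vdash t:A,\Delta$ infer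 $\Gamma\vdash t:\forall x\,A,\Delta$ (resp. $\Gamma\vdash t:\forall X\,A,\Delta$) if $x$ (resp. $X$) is not free in $\Gamma,\Delta$; - from $\Gamma\vdash t:\forall x\,A,\Delta$ infer $\Gamma\vdash t:A[a/x],\Delta$ for every individual term $a$; from $\Gamma\vdash t:\forall X\,A,\Delta$ infer $\Gamma\vdash t:A[G/X],\Delta$ for every formula $G$; - from $\Gamma\vdash t:A[a/x],\Delta$ infer $\Gamma\vdash t:A[b/x],\Delta$ if $E\vdash a=b$; - from $\Gamma\vdash t:A,\ \beta:B,\Delta$ infer $\Gamma\vdash\mu\beta[\alpha]t:B,\ \alpha:A,\Delta$ if $\alpha\ne\beta$, and $\Gamma\vdash\mu\beta[\beta]t:B,\Delta$ if $\alpha=\beta$ (and $A=B$). Let $N[a]=\forall X\{X(0)\to(\forall y(X(y)\to X(sy))\to X(a))\}$. A classical integer of value $n$ is a closed term $\theta$ with $\vdash\theta:N[s^n(0)]$. **Statement.** Let $\overline n=\lambda x\lambda f\,(f)^n x$, $\ \overline s=\lambda n\lambda x\lambda f\,(f)((n)x)f$, and $$T_1=\lambda n\,((n)\delta)G,\quad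 \delta=\lambda f\,(f)\overline 0,\quad G=\lambda x\lambda y\,(x)\lambda z\,(y)(\overline s)z;\qquad T_2=\lambda n\lambda f\,(((n)f)F)\overline 0,\quad F=\lambda x\lambda y\,(x)(\overline s)y.$$ If $\theta$ is a normal classical integer of value $n$ (with respect to any adequate $E$), then for $i=1$ and for $i=2$, and for every $\lambda$-variable $f$, $$((T_i)\theta)f\succ(f)(\overline s)^n\overline 0 .$$ Moreover $((T_i)\theta)\lambda x\,x\succ(\lambda x\,x)(\overline s)^n\overline 0\to\overline n$; in particular $((T_i)\theta)\lambda x\,x\to\overline n$. -/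

import Mathlib

universe u v

/-! ### Pure terms -/

/-- Terms of the pure `λμ`-calculus up to renaming of bound variables, with one space of de Bruijn
indices for the `λ`-variables and another one for the `μ`-variables. `mu b t` is `μα[β]t`, where the
index `b` of `β` is read inside the scope of `α`: `b = 0` means `β = α`. -/
inductive LMTerm : Type
  | var (x : ℕ) : LMTerm
  | lam (t : LMTerm) : LMTerm
  | app (t s : LMTerm) : LMTerm
  | mu (b : ℕ) (t : LMTerm) : LMTerm

namespace LMTerm

/-- Extension of a renaming under one binder. -/
def liftRen (r : ℕ → ℕ) : ℕ → ℕ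
  | 0 => 0
  | x + 1 => r x + 1

/-- Renaming of the `λ`-variables. -/
def renLam (r : ℕ → ℕ) : LMTerm → LMTerm
  | var x => var (r x)
  | lam t => lam (t.renLam (liftRen r))
  | app t s => app (t.renLam r) (s.renLam r)
  | mu b t => mu b (t.renLam r)

/-- Renaming of the `μ`-variables. -/
def renMu (r : ℕ → ℕ) : LMTerm → LMTerm
  | var x => var x
  | lam t => lam (t.renMu r)
  | app t s => app (t.renMu r) (s.renMu r)
  | mu b t => mu (liftRen r b) (t.renMu (liftRen r))

/-- The same term, placed under one more `λ`. -/
def shiftLam (t : LMTerm) : LMTerm := t.renLam Nat.succ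

/-- The same term, placed under one more `μ`. -/
def shiftMu (t : LMTerm) : LMTerm := t.renMu Nat.succ

/-- Extension of a substitution under one `λ`. -/
def liftSubst (σ : ℕ → LMTerm) : ℕ → LMTerm
  | 0 => var 0
  | x + 1 => (σ x).shiftLam

/-- Capture-avoiding simultaneous substitution for the `λ`-variables. -/
def subst (σ : ℕ → LMTerm) : LMTerm → LMTerm
  | var x => σ x
  | lam t => lam (t.subst (liftSubst σ))
  | app t s => app (t.subst σ) (s.subst σ)
  | mu b t => mu b (t.subst (fun x => (σ x).shiftMu))

/-- `t[v/x]`, where `x` is the `λ`-variable `0` of `t`, which disappears. -/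
def inst (t v : LMTerm) : LMTerm :=
  t.subst (fun x => match x with
    | 0 => v
    | x + 1 => var x)

/-- `t[v/*α]`, where `α` is the `μ`-variable of index `a` and `v` lives in the same scope as `t`:
every subterm `[α]w` is replaced, inductively, by `[α](w)v`. -/
def muSubst : LMTerm → ℕ → LMTerm → LMTerm
  | var x, _, _ => var x
  | lam t, a, v => lam (t.muSubst a v.shiftLam)
  | app t s, a, v => app (t.muSubst a v) (s.muSubst a v)
  | mu b t, a, v =>
      mu b (if b = a + 1 then app (t.muSubst (a + 1) v.shiftMu) v.shiftMu
        else t.muSubst (a + 1) v.shiftMu)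

/-- `μα u[v/*α]`, where `u` is the named term `[b]t` in the scope of `α` and `v` lives outside of
this scope. -/
def muApp (b : ℕ) (t v : LMTerm) : LMTerm :=
  mu b (if b = 0 then app (t.muSubst 0 v.shiftMu) v.shiftMu else t.muSubst 0 v.shiftMu)

/-- The term is an abstraction `λy w`. -/
def IsLam : LMTerm → Prop
  | lam _ => True
  | _ => False

/-- The term contains a subterm of the form `[α]λy w`, where `α` is the free `μ`-variable `a`. -/
def HasNamedLam (a : ℕ) : LMTerm → Prop
  | var _ => False
  | lam t => t.HasNamedLam a
  | app t s => t.HasNamedLam a ∨ s.HasNamedLam a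
  | mu b t => (b = a + 1 ∧ t.IsLam) ∨ t.HasNamedLam (a + 1)

/-- All free `λ`-variables are `< k` and all free `μ`-variables are `< m`. -/
def ClosedAt (k m : ℕ) : LMTerm → Prop
  | var x => x < k
  | lam t => t.ClosedAt (k + 1) m
  | app t s => t.ClosedAt k m ∧ s.ClosedAt k m
  | mu b t => b < m + 1 ∧ t.ClosedAt k (m + 1)

/-- Closed terms: no free `λ`-variable and no free `μ`-variable. -/
def Closed (t : LMTerm) : Prop := t.ClosedAt 0 0

/-! ### Reduction -/

/-- Contraction of a redex that is a term: the rules `(C₁)`, `(C₂)`, `(S₂)`, `(S₃)`.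
* `(C₁)` `(λx u)v → u[v/x]`;
* `(C₂)` `(μα u)v → μα u[v/*α]`;
* `(S₂)` `μα[α]u → u`, if `α` is not free in `u` (that is, `u` comes from outside of the scope);
* `(S₃)` `μα u → λx μα u[x/*α]`, if `u` contains a subterm of the form `[α]λy w`. -/
inductive Contract : LMTerm → LMTerm → Prop
  | c1 (t v : LMTerm) : Contract (app (lam t) v) (t.inst v)
  | c2 (b : ℕ) (t v : LMTerm) : Contract (app (mu b t) v) (muApp b t v)
  | s2 (t : LMTerm) : Contract (mu 0 t.shiftMu) t
  | s3 (b : ℕ) (t : LMTerm) (h : (b = 0 ∧ t.IsLam) ∨ t.HasNamedLam 0) :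
      Contract (mu b t) (lam (muApp b t.shiftLam (var 0)))

/-- The renaming `[α/β]` of the `μ`-variable `β` of index `0`, which disappears. -/
def renInst (a : ℕ) : ℕ → ℕ
  | 0 => a
  | x + 1 => x

/-- Contraction of a redex that is a named term: `ContractNamed a t b t'` says that
`[a]t → [b]t'` by the rule `(S₁)` `[α]μβ u → u[α/β]`. -/
inductive ContractNamed : ℕ → LMTerm → ℕ → LMTerm → Prop
  | s1 (a b : ℕ) (t : LMTerm) :
      ContractNamed a (mu b t) (renInst a b) (t.renMu (renInst a))

/-- The term is itself a redex. -/
def IsRedex (t : LMTerm) : Prop := ∃ t', Contract t t'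

/-- The named term `[a]t` is itself a redex. -/
def IsNamedRedex (a : ℕ) (t : LMTerm) : Prop := ∃ b t', ContractNamed a t b t'

/-- One step of reduction, at any place of the term. -/
inductive Step : LMTerm → LMTerm → Prop
  | root {t t' : LMTerm} (h : Contract t t') : Step t t'
  | named {a b : ℕ} {t t' : LMTerm} (h : ContractNamed a t b t') : Step (mu a t) (mu b t')
  | lam {t t' : LMTerm} (h : Step t t') : Step (lam t) (lam t')
  | appL {t t' : LMTerm} (s : LMTerm) (h : Step t t') : Step (app t s) (app t' s)
  | appR (t : LMTerm) {s s' : LMTerm} (h : Step s s') : Step (app t s) (app t s')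
  | mu (b : ℕ) {t t' : LMTerm} (h : Step t t') : Step (mu b t) (mu b t')

/-- The reduction `t → t'` of the `λμ`-calculus, in any finite number of steps. -/
def Red : LMTerm → LMTerm → Prop := Relation.ReflTransGen Step

/-- Normal terms: no redex at all. -/
def Normal (t : LMTerm) : Prop := ∀ t', ¬ Step t t'

/-- Head normal forms. -/
inductive Hnf : LMTerm → Prop
  | var (x : ℕ) : Hnf (var x)
  | lam {t : LMTerm} (h : Hnf t) : Hnf (lam t)
  | app {t s : LMTerm} (h : Hnf t) (hr : ¬ IsRedex (app t s)) : Hnf (app t s)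
  | mu {b : ℕ} {t : LMTerm} (h : Hnf t) (hr : ¬ IsRedex (mu b t)) (hn : ¬ IsNamedRedex b t) :
      Hnf (mu b t)

/-- One step of reduction that contracts the leftmost redex. -/
inductive Leftmost : LMTerm → LMTerm → Prop
  | root {t t' : LMTerm} (h : Contract t t') : Leftmost t t'
  | named {a b : ℕ} {t t' : LMTerm} (hr : ¬ IsRedex (mu a t)) (h : ContractNamed a t b t') :
      Leftmost (mu a t) (mu b t')
  | lam {t t' : LMTerm} (h : Leftmost t t') : Leftmost (lam t) (lam t')
  | appL {t t' s : LMTerm} (hr : ¬ IsRedex (app t s)) (h : Leftmost t t') :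
      Leftmost (app t s) (app t' s)
  | appR {t s s' : LMTerm} (hr : ¬ IsRedex (app t s)) (hn : Normal t) (h : Leftmost s s') :
      Leftmost (app t s) (app t s')
  | mu {b : ℕ} {t t' : LMTerm} (hr : ¬ IsRedex (mu b t)) (hn : ¬ IsNamedRedex b t)
      (h : Leftmost t t') : Leftmost (mu b t) (mu b t')

/-- One step of head reduction. -/
def HeadStep (t t' : LMTerm) : Prop := ¬ Hnf t ∧ Leftmost t t'

/-- Head reduction `t ≻ t'`. -/
def HeadRed : LMTerm → LMTerm → Prop := Relation.ReflTransGen HeadStep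

/-! ### Integers and storage operators -/

/-- `(s)ⁿ t`. -/
def iterApp (s : LMTerm) (n : ℕ) (t : LMTerm) : LMTerm := (app s)^[n] t

/-- The Church integer `λx λf (f)ⁿ x`. -/
def church (n : ℕ) : LMTerm := lam (lam (iterApp (var 0) n (var 1)))

/-- The successor `λn λx λf (f)((n)x)f`. -/
def succTerm : LMTerm :=
  lam (lam (lam (app (var 0) (app (app (var 2) (var 1)) (var 0)))))

/-- `λx x`. -/
def idTerm : LMTerm := lam (var 0)

/-- `δ = λf (f)0`. -/
def deltaTerm : LMTerm := lam (app (var 0) (church 0))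

/-- `G = λx λy (x)λz (y)(s)z`. -/
def gTerm : LMTerm :=
  lam (lam (app (var 1) (lam (app (var 1) (app succTerm (var 0))))))

/-- `F = λx λy (x)(s)y`. -/
def fTerm : LMTerm := lam (lam (app (var 1) (app succTerm (var 0))))

/-- `T₁ = λn ((n)δ)G`. -/
def storage1 : LMTerm := lam (app (app (var 0) deltaTerm) gTerm)

/-- `T₂ = λn λf (((n)f)F)0`. -/
def storage2 : LMTerm :=
  lam (lam (app (app (app (var 1) (var 0)) fTerm) (church 0)))

end LMTerm

/-! ### Types: formulas of second order predicate calculus -/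

/-- Formulas of second order predicate calculus over the language `L`, up to renaming of bound
variables. There is one space of de Bruijn indices for the individual variables and, for every
arity `k`, one for the relation variables of arity `k`: `rvar k X ts` is `X(ts)`, `all1` quantifies
over individuals and `all2 k` over relations of arity `k`. -/
inductive SOForm (L : FirstOrder.Language.{u, v}) : Type (max u v)
  | bot : SOForm L
  | rel {k : ℕ} (R : L.Relations k) (ts : Fin k → L.Term ℕ) : SOForm L
  | rvar (k X : ℕ) (ts : Fin k → L.Term ℕ) : SOForm L
  | imp (A B : SOForm L) : SOForm L
  | all1 (A : SOForm L) : SOForm L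
  | all2 (k : ℕ) (A : SOForm L) : SOForm L

namespace SOForm

variable {L : FirstOrder.Language.{u, v}}

/-- Extension of an individual substitution under one individual quantifier. -/
def lift1 (σ : ℕ → L.Term ℕ) : ℕ → L.Term ℕ
  | 0 => FirstOrder.Language.Term.var 0
  | x + 1 => (σ x).relabel Nat.succ

/-- Simultaneous substitution for the individual variables. -/
def subst1 (σ : ℕ → L.Term ℕ) : SOForm L → SOForm L
  | bot => bot
  | rel R ts => rel R (fun i => (ts i).subst σ)
  | rvar k X ts => rvar k X (fun i => (ts i).subst σ)
  | imp A B => imp (A.subst1 σ) (B.subst1 σ)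
  | all1 A => all1 (A.subst1 (lift1 σ))
  | all2 k A => all2 k (A.subst1 σ)

/-- The same formula, placed under one more individual quantifier. -/
def shift1 (A : SOForm L) : SOForm L := A.subst1 (fun x => FirstOrder.Language.Term.var (x + 1))

/-- `A[u/x]`, where `x` is the individual variable `0` of `A`, which disappears. -/
def inst1 (u : L.Term ℕ) (A : SOForm L) : SOForm L :=
  A.subst1 (fun x => match x with
    | 0 => u
    | x + 1 => FirstOrder.Language.Term.var x)

/-- Extension of a renaming of relation variables under a quantifier over relations of
arity `k`. -/
def liftRen2 (k : ℕ) (r : ℕ → ℕ → ℕ) (j : ℕ) : ℕ → ℕ :=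
  if j = k then LMTerm.liftRen (r j) else r j

/-- Renaming of the relation variables: `X` of arity `k` becomes `r k X`. -/
def ren2 (r : ℕ → ℕ → ℕ) : SOForm L → SOForm L
  | bot => bot
  | rel R ts => rel R ts
  | rvar k X ts => rvar k (r k X) ts
  | imp A B => imp (A.ren2 r) (B.ren2 r)
  | all1 A => all1 (A.ren2 r)
  | all2 k A => all2 k (A.ren2 (liftRen2 k r))

/-- The same formula, placed under one more quantifier over relations of arity `k`. -/
def shift2 (k : ℕ) (A : SOForm L) : SOForm L :=
  A.ren2 (fun j X => if j = k then X + 1 else X)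

/-- A formula `G` stands for the relation of arity `k` whose parameters are the individual
variables `0, …, k - 1` of `G` and in which the individual variable `k + x` of `G` denotes the
ambient variable `x`. This is the substitution that applies such a relation to `ts`. -/
def args {k : ℕ} (ts : Fin k → L.Term ℕ) (x : ℕ) : L.Term ℕ :=
  if h : x < k then ts ⟨x, h⟩ else FirstOrder.Language.Term.var (x - k)

/-- The relation variable `X` of arity `k`, as a formula with `k` parameters. -/
def rvarAbs (k X : ℕ) : SOForm L := rvar k X (fun i => FirstOrder.Language.Term.var (i : ℕ))

/-- Simultaneous substitution for the relation variables: `X(ts)`, with `X` of arity `k`, is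
replaced by the formula `τ k X` with parameters `ts`. -/
def subst2 (τ : ℕ → ℕ → SOForm L) : SOForm L → SOForm L
  | bot => bot
  | rel R ts => rel R ts
  | rvar k X ts => (τ k X).subst1 (args ts)
  | imp A B => imp (A.subst2 τ) (B.subst2 τ)
  | all1 A => all1 (A.subst2 (fun k X => (τ k X).subst1
      (fun x => FirstOrder.Language.Term.var (if x < k then x else x + 1))))
  | all2 k A => all2 k (A.subst2 (fun j X =>
      if j = k then
        match X with
        | 0 => rvarAbs j 0
        | X + 1 => (τ j X).shift2 k
      else (τ j X).shift2 k))

/-- `A[G/X]`, where `X` is the relation variable `0` of arity `k` of `A`, which disappears, and `G`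
is a formula with `k` parameters. -/
def inst2 (A : SOForm L) (k : ℕ) (G : SOForm L) : SOForm L :=
  A.subst2 (fun j X =>
    if j = k then
      match X with
      | 0 => G
      | X + 1 => rvarAbs j X
    else rvarAbs j X)

/-- `N[a] = ∀X {X(0), ∀y(X(y) → X(sy)) → X(a)}`. -/
def nat (zero : L.Functions 0) (succ : L.Functions 1) (a : L.Term ℕ) : SOForm L :=
  all2 1 (imp (rvar 1 0 ![FirstOrder.Language.Constants.term zero])
    (imp (all1 (imp (rvar 1 0 ![FirstOrder.Language.Term.var 0])
        (rvar 1 0 ![succ.apply₁ (FirstOrder.Language.Term.var 0)])))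
      (rvar 1 0 ![a])))

end SOForm

/-! ### Equations and typing -/

/-- `EqConseq E a b`: the equation `a = b` is a consequence of the set `E` of (universally
quantified) equations. -/
inductive EqConseq {L : FirstOrder.Language.{u, v}} (E : Set (L.Term ℕ × L.Term ℕ)) :
    L.Term ℕ → L.Term ℕ → Prop
  | ax {a b : L.Term ℕ} (h : (a, b) ∈ E) (σ : ℕ → L.Term ℕ) :
      EqConseq E (a.subst σ) (b.subst σ)
  | refl (a : L.Term ℕ) : EqConseq E a a
  | symm {a b : L.Term ℕ} (h : EqConseq E a b) : EqConseq E b a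
  | trans {a b c : L.Term ℕ} (h : EqConseq E a b) (h' : EqConseq E b c) : EqConseq E a c
  | func {k : ℕ} (f : L.Functions k) {as bs : Fin k → L.Term ℕ}
      (h : ∀ i, EqConseq E (as i) (bs i)) :
      EqConseq E (FirstOrder.Language.Term.func f as) (FirstOrder.Language.Term.func f bs)

/-- `E` is adequate for the type of integers. -/
def Adequate {L : FirstOrder.Language.{u, v}} (zero : L.Functions 0) (succ : L.Functions 1)
    (E : Set (L.Term ℕ × L.Term ℕ)) : Prop :=
  (∀ a : L.Term ℕ, ¬ EqConseq E (succ.apply₁ a) (FirstOrder.Language.Constants.term zero)) ∧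
  (∀ a b : L.Term ℕ, EqConseq E (succ.apply₁ a) (succ.apply₁ b) → EqConseq E a b)

/-- `Typing E Γ t A Δ` is the judgment `Γ ⊢ t : A, Δ` modulo the set of equations `E`. The `i`-th
formulas of `Γ` and `Δ` are labelled by the `λ`-variable and the `μ`-variable of index `i`. In the
introduction rules for `∀` the contexts are shifted, which says that the quantified variable is not
free in them. -/
inductive Typing {L : FirstOrder.Language.{u, v}} (E : Set (L.Term ℕ × L.Term ℕ)) :
    List (SOForm L) → LMTerm → SOForm L → List (SOForm L) → Prop
  | ax {Γ Δ : List (SOForm L)} {x : ℕ} {A : SOForm L} (h : Γ[x]? = some A) :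
      Typing E Γ (LMTerm.var x) A Δ
  | lam {Γ Δ : List (SOForm L)} {t : LMTerm} {A B : SOForm L} (h : Typing E (A :: Γ) t B Δ) :
      Typing E Γ (LMTerm.lam t) (SOForm.imp A B) Δ
  | app {Γ Δ : List (SOForm L)} {t s : LMTerm} {A B : SOForm L}
      (h : Typing E Γ t (SOForm.imp A B) Δ) (h' : Typing E Γ s A Δ) :
      Typing E Γ (LMTerm.app t s) B Δ
  | all1I {Γ Δ : List (SOForm L)} {t : LMTerm} {A : SOForm L}
      (h : Typing E (Γ.map SOForm.shift1) t A (Δ.map SOForm.shift1)) :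
      Typing E Γ t (SOForm.all1 A) Δ
  | all1E {Γ Δ : List (SOForm L)} {t : LMTerm} {A : SOForm L} (a : L.Term ℕ)
      (h : Typing E Γ t (SOForm.all1 A) Δ) : Typing E Γ t (A.inst1 a) Δ
  | all2I {Γ Δ : List (SOForm L)} {t : LMTerm} {k : ℕ} {A : SOForm L}
      (h : Typing E (Γ.map (SOForm.shift2 k)) t A (Δ.map (SOForm.shift2 k))) :
      Typing E Γ t (SOForm.all2 k A) Δ
  | all2E {Γ Δ : List (SOForm L)} {t : LMTerm} {k : ℕ} {A : SOForm L} (G : SOForm L)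
      (h : Typing E Γ t (SOForm.all2 k A) Δ) : Typing E Γ t (A.inst2 k G) Δ
  | eq {Γ Δ : List (SOForm L)} {t : LMTerm} {A : SOForm L} {a b : L.Term ℕ}
      (hab : EqConseq E a b) (h : Typing E Γ t (A.inst1 a) Δ) : Typing E Γ t (A.inst1 b) Δ
  | mu {Γ Δ : List (SOForm L)} {t : LMTerm} {A B : SOForm L} {b : ℕ}
      (hb : (B :: Δ)[b]? = some A) (h : Typing E Γ t A (B :: Δ)) :
      Typing E Γ (LMTerm.mu b t) B Δ

/-- The individual term `sⁿ(0)`. -/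
def numeral {L : FirstOrder.Language.{u, v}} (zero : L.Functions 0) (succ : L.Functions 1) (n : ℕ) :
    L.Term ℕ :=
  (fun a => succ.apply₁ a)^[n] (FirstOrder.Language.Constants.term zero)

/-- `θ` is a classical integer of value `n` (modulo `E`): a closed term of type `N[sⁿ(0)]`. -/
def IsClassicalInteger {L : FirstOrder.Language.{u, v}} (zero : L.Functions 0) (succ : L.Functions 1)
    (E : Set (L.Term ℕ × L.Term ℕ)) (n : ℕ) (θ : LMTerm) : Prop :=
  θ.Closed ∧ Typing E [] θ (SOForm.nat zero succ (numeral zero succ n)) []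

/-!
The type of `θ` is used through Krivine's realizability only. Run `θ` on an abstract machine, with
a constant that reads a counter in place of `x` and a constant that increments it in place of `f`.
Interpreting `X(d)` in the term model of `E` by the counters `j` with `sʲ(d) = sⁿ(0)`, one sees that
the run ends at a counter `m` with `E ⊢ sᵐ(0) = sⁿ(0)`. A normal closed term whose run ends is of the
form `λxλf t` with `t ::= x | (f)t | μα[β]t`, since any other shape gets stuck, and `m` is the value
of `t` as a counter program in which `μα[β]` saves the counter as `α` and jumps to the one that was
saved as `β`.

The head reduction of `(((θ)d)λxλy (x)h)k₀` executes the same program, with a term `k_j` in place of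
the counter `j`: `(f)t` turns `k_j` into `k_{j+1} = h[k_j/y]`, and a `μ` distributes `k_j` over its
names by `(C₂)`. From then on, as long as the rest `t` of the program has a free name, the term is
`μα[α](t)k_j`, where all free names of `t` are `α` and already carry their arguments. Hence neither
`(S₂)` nor `(S₃)` applies, and an inner `μ` first absorbs `k_j` by `(C₂)` and then merges with the
outer one by `(S₁)`. When `t` has no free name left, `(S₂)` removes the `μ`. For `T₁` the terms are
`k_{j+1} = λz (k_j)(s)z` with `k₀ = f`, for `T₂` they are `k_j = (s)ʲ0`.
-/

/-- The sequence `a, e 0, e 1, …`, which extends environments and valuations under a binder. -/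
def seqCons {α : Type*} (a : α) (e : ℕ → α) : ℕ → α
  | 0 => a
  | x + 1 => e x

namespace LMTerm

/-! ### Renaming and substitution -/

theorem liftRen_liftRen (r s : ℕ → ℕ) (x : ℕ) :
    liftRen r (liftRen s x) = liftRen (fun y => r (s y)) x := by
  cases x <;> rfl

theorem renMu_renMu (r s : ℕ → ℕ) (t : LMTerm) :
    (t.renMu s).renMu r = t.renMu (fun a => r (s a)) := by
  induction t generalizing r s with
  | var x => rfl
  | lam t ih => simp only [renMu, ih]
  | app t u iht ihu => simp only [renMu, iht, ihu]
  | mu b t ih => simp only [renMu, ih, liftRen_liftRen]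

theorem liftRen_id : liftRen (fun x => x) = fun x => x := by
  funext x
  cases x <;> rfl

theorem renMu_id (t : LMTerm) : t.renMu (fun a => a) = t := by
  induction t with
  | var x => rfl
  | lam t ih => rw [renMu, ih]
  | app t u iht ihu => rw [renMu, iht, ihu]
  | mu b t ih => rw [renMu, liftRen_id, ih]

theorem shiftMu_renMu (r : ℕ → ℕ) (t : LMTerm) :
    t.shiftMu.renMu (liftRen r) = (t.renMu r).shiftMu := by
  simp only [shiftMu, renMu_renMu, liftRen]

theorem shiftMu_renMu_renInst (a : ℕ) (t : LMTerm) : t.shiftMu.renMu (renInst a) = t := by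
  rw [shiftMu, renMu_renMu]
  exact renMu_id t

theorem renLam_renMu (r s : ℕ → ℕ) (t : LMTerm) :
    (t.renMu s).renLam r = (t.renLam r).renMu s := by
  induction t generalizing r s with
  | var x => rfl
  | lam t ih => simp only [renMu, renLam, ih]
  | app t u iht ihu => simp only [renMu, renLam, iht, ihu]
  | mu b t ih => simp only [renMu, renLam, ih]

theorem subst_renLam (σ : ℕ → LMTerm) (r : ℕ → ℕ) (t : LMTerm) :
    (t.renLam r).subst σ = t.subst (fun x => σ (r x)) := by
  induction t generalizing σ r with
  | var x => rfl
  | lam t ih =>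
    simp only [renLam, subst, ih]
    congr 2
    funext x
    cases x <;> rfl
  | app t u iht ihu => simp only [renLam, subst, iht, ihu]
  | mu b t ih => simp only [renLam, subst, ih]

theorem renMu_subst (σ : ℕ → LMTerm) (r : ℕ → ℕ) (t : LMTerm) :
    (t.subst σ).renMu r = (t.renMu r).subst (fun x => (σ x).renMu r) := by
  induction t generalizing σ r with
  | var x => rfl
  | lam t ih =>
    simp only [renMu, subst, ih]
    congr 2
    funext x
    cases x with
    | zero => rfl
    | succ x => simp only [liftSubst, shiftLam, renLam_renMu]
  | app t u iht ihu => simp only [renMu, subst, iht, ihu]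
  | mu b t ih => simp only [renMu, subst, ih, shiftMu_renMu]

theorem subst_var (t : LMTerm) : t.subst var = t := by
  induction t with
  | var x => rfl
  | lam t ih =>
    have h : liftSubst var = var := by
      funext x
      cases x <;> rfl
    rw [subst, h, ih]
  | app t u iht ihu => rw [subst, iht, ihu]
  | mu b t ih =>
    have h : (fun x => (var x).shiftMu) = var := rfl
    rw [subst, h, ih]

theorem inst_shiftLam (t v : LMTerm) : t.shiftLam.inst v = t := by
  rw [inst, shiftLam, subst_renLam]
  exact subst_var t

theorem shiftMu_inst (t v : LMTerm) : (t.inst v).shiftMu = t.shiftMu.inst v.shiftMu := by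
  rw [shiftMu, inst, renMu_subst, inst]
  congr 1
  funext x
  cases x <;> rfl

/-! ### Free `μ`-variables -/

/-- The `μ`-variable `a` occurs free. -/
def MuFree (a : ℕ) : LMTerm → Prop
  | var _ => False
  | lam t => t.MuFree a
  | app t s => t.MuFree a ∨ s.MuFree a
  | mu b t => b = a + 1 ∨ t.MuFree (a + 1)

theorem ClosedAt.not_muFree {t : LMTerm} {k m a : ℕ} (h : t.ClosedAt k m) (ha : m ≤ a) :
    ¬ t.MuFree a := by
  induction t generalizing k m a with
  | var x => exact id
  | lam t ih => exact ih (k := k + 1) h ha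
  | app t u iht ihu => exact not_or.2 ⟨iht h.1 ha, ihu h.2 ha⟩
  | mu b t ih =>
    have hb : b < m + 1 := h.1
    exact not_or.2 ⟨by lia, ih h.2 (by lia)⟩

theorem muFree_renLam {t : LMTerm} {a : ℕ} {r : ℕ → ℕ} : (t.renLam r).MuFree a ↔ t.MuFree a := by
  induction t generalizing a r with
  | var x => rfl
  | lam _ ih => exact ih
  | app t u iht ihu => exact or_congr iht ihu
  | mu b t ih => exact or_congr Iff.rfl ih

theorem liftRen_eq_succ {r : ℕ → ℕ} {a b : ℕ} :
    liftRen r a = b + 1 ↔ ∃ c, a = c + 1 ∧ r c = b := by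
  cases a <;> simp [liftRen]

theorem muFree_renMu {t : LMTerm} {b : ℕ} {r : ℕ → ℕ} :
    (t.renMu r).MuFree b ↔ ∃ a, t.MuFree a ∧ r a = b := by
  induction t generalizing b r with
  | var x => simp [renMu, MuFree]
  | lam _ ih => exact ih
  | app t u iht ihu =>
    simp only [renMu, MuFree, iht, ihu, or_and_right, exists_or]
  | mu c t ih =>
    simp only [renMu, MuFree, ih, liftRen_eq_succ, or_and_right, exists_or]
    exact or_congr Iff.rfl
      ⟨fun ⟨_, ha, c, hc, hr⟩ => ⟨c, hc ▸ ha, hr⟩, fun ⟨c, hc, hr⟩ => ⟨_, hc, c, rfl, hr⟩⟩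

theorem not_muFree_shiftMu_zero (t : LMTerm) : ¬ t.shiftMu.MuFree 0 := by
  simp [shiftMu, muFree_renMu]

theorem muFree_shiftMu_succ {t : LMTerm} {a : ℕ} : t.shiftMu.MuFree (a + 1) ↔ t.MuFree a := by
  simp [shiftMu, muFree_renMu]

theorem muSubst_eq_self {t : LMTerm} {a : ℕ} (h : ¬ t.MuFree a) (v : LMTerm) :
    t.muSubst a v = t := by
  induction t generalizing a v with
  | var x => rfl
  | lam t ih => rw [muSubst, ih h]
  | app t u iht ihu => rw [muSubst, iht (not_or.1 h).1, ihu (not_or.1 h).2]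
  | mu b t ih => rw [muSubst, if_neg (not_or.1 h).1, ih (not_or.1 h).2]

theorem HasNamedLam.muFree {t : LMTerm} {a : ℕ} (h : t.HasNamedLam a) : t.MuFree a := by
  induction t generalizing a with
  | var x => exact h
  | lam t ih => exact ih h
  | app t u iht ihu => exact h.imp iht ihu
  | mu b t ih => exact h.imp And.left ih

theorem isLam_renLam {t : LMTerm} {r : ℕ → ℕ} : (t.renLam r).IsLam ↔ t.IsLam := by
  cases t <;> rfl

theorem hasNamedLam_renLam {t : LMTerm} {a : ℕ} {r : ℕ → ℕ} :
    (t.renLam r).HasNamedLam a ↔ t.HasNamedLam a := by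
  induction t generalizing a r with
  | var x => rfl
  | lam _ ih => exact ih
  | app t u iht ihu => exact or_congr iht ihu
  | mu b t ih => exact or_congr (and_congr Iff.rfl isLam_renLam) ih

/-- The variable `α` of index `0` occurs free in `t` but names no abstraction in `t`: when `t` is
not itself an abstraction, this is what prevents `μα[β]t` from being a redex. -/
def MuStable (t : LMTerm) : Prop := t.MuFree 0 ∧ ¬ t.HasNamedLam 0

theorem MuStable.app_left {t s : LMTerm} (ht : t.MuStable) (hs : ¬ s.MuFree 0) :
    (app t s).MuStable :=
  ⟨.inl ht.1, not_or.2 ⟨ht.2, fun h => hs h.muFree⟩⟩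

theorem MuStable.app_right {t s : LMTerm} (hs : s.MuStable) (ht : ¬ t.MuFree 0) :
    (app t s).MuStable :=
  ⟨.inr hs.1, not_or.2 ⟨fun h => ht h.muFree, hs.2⟩⟩

theorem MuStable.lam {t : LMTerm} (ht : t.MuStable) : (lam t).MuStable := ht

theorem MuStable.shiftLam {t : LMTerm} (ht : t.MuStable) : t.shiftLam.MuStable :=
  ⟨muFree_renLam.2 ht.1, fun h => ht.2 (hasNamedLam_renLam.1 h)⟩

/-! ### Head reduction steps -/

theorem Hnf.not_isRedex {t : LMTerm} (h : Hnf t) : ¬ IsRedex t := by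
  cases h with
  | var x => rintro ⟨_, ⟨⟩⟩
  | lam h => rintro ⟨_, ⟨⟩⟩
  | app h hr => exact hr
  | mu h hr hn => exact hr

theorem Contract.headStep {t t' : LMTerm} (h : Contract t t') : HeadStep t t' :=
  ⟨fun h' => h'.not_isRedex ⟨t', h⟩, .root h⟩

theorem headStep_beta (t v : LMTerm) : HeadStep (app (lam t) v) (t.inst v) :=
  (Contract.c1 t v).headStep

theorem HeadStep.app {t t' s : LMTerm} (h : HeadStep t t') (hr : ¬ IsRedex (app t s)) :
    HeadStep (app t s) (app t' s) :=
  ⟨fun h' => by cases h' with | app h' _ => exact h.1 h', .appL hr h.2⟩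

theorem HeadStep.mu {b : ℕ} {t t' : LMTerm} (h : HeadStep t t') (hr : ¬ IsRedex (mu b t))
    (hn : ¬ IsNamedRedex b t) : HeadStep (mu b t) (mu b t') :=
  ⟨fun h' => by cases h' with | mu h' _ _ => exact h.1 h', .mu hr hn h.2⟩

theorem HeadStep.app_app {t s t' : LMTerm} (h : HeadStep (LMTerm.app t s) t') (u : LMTerm) :
    HeadStep (LMTerm.app (LMTerm.app t s) u) (LMTerm.app t' u) :=
  h.app (by rintro ⟨_, ⟨⟩⟩)

theorem MuStable.not_isRedex {t : LMTerm} (h : t.MuStable) (hl : ¬ t.IsLam) (b : ℕ) :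
    ¬ IsRedex (mu b t) := by
  rintro ⟨_, hc⟩
  cases hc with
  | s2 => exact not_muFree_shiftMu_zero _ h.1
  | s3 _ _ h' => exact h'.elim (fun h' => hl h'.2) h.2

theorem HeadStep.mu_app {t s t' : LMTerm} (h : HeadStep (LMTerm.app t s) t')
    (hs : (LMTerm.app t s).MuStable) (b : ℕ) :
    HeadStep (LMTerm.mu b (LMTerm.app t s)) (LMTerm.mu b t') :=
  h.mu (hs.not_isRedex id b) (by rintro ⟨_, _, ⟨⟩⟩)

theorem MuStable.headStep_mu_mu {b : ℕ} {t : LMTerm} (h : (mu b t).MuStable) (a : ℕ) :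
    HeadStep (mu a (mu b t)) (mu (renInst a b) (t.renMu (renInst a))) :=
  ⟨fun h' => by cases h' with | mu _ _ hn => exact hn ⟨_, _, .s1 a b t⟩,
    .named (h.not_isRedex id a) (.s1 a b t)⟩

theorem Leftmost.step {t t' : LMTerm} (h : Leftmost t t') : Step t t' := by
  induction h with
  | root h => exact .root h
  | named _ h => exact .named h
  | lam _ ih => exact .lam ih
  | appL _ _ ih => exact .appL _ ih
  | appR _ _ _ ih => exact .appR _ ih
  | mu _ _ _ ih => exact .mu _ ih

theorem HeadRed.red {t t' : LMTerm} (h : HeadRed t t') : Red t t' :=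
  Relation.ReflTransGen.mono (fun _ _ h => h.2.step) _ _ h

end LMTerm

namespace LMTerm

/-! ### Bodies of integers -/

/-- The bodies `t ::= x | (f)t | μα[β]t` of the normal classical integers `λxλf t`, with the
`μ`-variables indexed as in `LMTerm`. -/
inductive IntBody : Type
  | zero : IntBody
  | succ (t : IntBody) : IntBody
  | mu (b : ℕ) (t : IntBody) : IntBody

/-- What has become of the `μ`-variables of a body after structural substitutions: `[β]w` now reads
`[a]w` if `β` is mapped to `(a, none)`, and `[a](w)v` if it is mapped to `(a, some v)`. -/
abbrev NameEnv : Type := ℕ → ℕ × Option LMTerm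

namespace NameEnv

/-- The environment that leaves all names unchanged. -/
def id : NameEnv := fun a => (a, none)

/-- Extension of an environment under one `μ`, whose variable gets the argument `o`. -/
def push (o : Option LMTerm) (E : NameEnv) : NameEnv
  | 0 => (0, o)
  | a + 1 => ((E a).1 + 1, (E a).2.map shiftMu)

/-- The term that takes the place of `w` in `[b]w`. -/
def arg (E : NameEnv) (b : ℕ) (w : LMTerm) : LMTerm := (E b).2.elim w (app w)

/-- The term `μα[b]w`, where `E` and `w` live in the scope of `α`. -/
def named (E : NameEnv) (b : ℕ) (w : LMTerm) : LMTerm := mu (E b).1 (E.arg b w)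

/-- Renaming of the `μ`-variables in which the environment takes its values. -/
def renMu (r : ℕ → ℕ) (E : NameEnv) : NameEnv := fun a => (r (E a).1, (E a).2.map (LMTerm.renMu r))

/-- The structural substitution `[v/*α]` with `α` of index `a`, when `a` is fresh in `E` in the
sense of `FreshAt`. -/
def muSubst (a : ℕ) (v : LMTerm) (E : NameEnv) : NameEnv :=
  fun b => if (E b).1 = a then (a, some v) else E b

/-- The variable `a` names no term that already has an argument, and it is not free in the
arguments. -/
def FreshAt (a : ℕ) (E : NameEnv) : Prop :=
  ∀ b w, (E b).2 = some w → (E b).1 ≠ a ∧ ¬ w.MuFree a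

/-- The variable `a` names only terms that already have an argument, and it is not free in the
arguments. -/
def AppliedAt (a : ℕ) (E : NameEnv) : Prop :=
  (∀ b, (E b).1 = a → (E b).2.isSome) ∧ ∀ b w, (E b).2 = some w → ¬ w.MuFree a

theorem push_none_id : push none id = id := by
  funext a
  cases a <;> rfl

theorem push_renMu (r : ℕ → ℕ) (o : Option LMTerm) (E : NameEnv) :
    (E.push o).renMu (liftRen r) = (E.renMu r).push (o.map (LMTerm.renMu (liftRen r))) := by
  funext a
  cases a with
  | zero => rfl
  | succ a => cases h : (E a).2 <;> simp [renMu, push, h, liftRen, shiftMu_renMu]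

theorem named_congr {E E' : NameEnv} {b : ℕ} (h : E b = E' b) (w : LMTerm) :
    E.named b w = E'.named b w := by
  rw [named, named, arg, arg, h]

theorem arg_renMu (r : ℕ → ℕ) (E : NameEnv) (b : ℕ) (w : LMTerm) :
    (E.arg b w).renMu r = (E.renMu r).arg b (w.renMu r) := by
  cases h : (E b).2 <;> simp [arg, renMu, h, LMTerm.renMu]

theorem named_renMu (r : ℕ → ℕ) (E : NameEnv) (b : ℕ) (w : LMTerm) :
    (E.named b w).renMu r = (E.renMu (liftRen r)).named b (w.renMu (liftRen r)) := by
  rw [named, LMTerm.renMu, arg_renMu]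
  rfl

theorem FreshAt.push_none {a : ℕ} {E : NameEnv} (h : E.FreshAt a) :
    (E.push none).FreshAt (a + 1) := by
  rintro (_ | b) w hw
  · cases hw
  · obtain ⟨u, hu, rfl⟩ := Option.map_eq_some_iff.1 hw
    exact ⟨fun h' => (h b u hu).1 (Nat.succ.inj h'), mt muFree_shiftMu_succ.1 (h b u hu).2⟩

theorem freshAt_push_none_zero (E : NameEnv) : (E.push none).FreshAt 0 := by
  rintro (_ | b) w hw
  · cases hw
  · obtain ⟨w, -, rfl⟩ := Option.map_eq_some_iff.1 hw
    exact ⟨Nat.succ_ne_zero _, not_muFree_shiftMu_zero w⟩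

theorem push_none_muSubst (a : ℕ) (v : LMTerm) (E : NameEnv) :
    (E.push none).muSubst (a + 1) v.shiftMu = (E.muSubst a v).push none := by
  funext b
  cases b with
  | zero => simp [muSubst, push]
  | succ b => by_cases h : (E b).1 = a <;> simp [muSubst, push, h]

theorem push_none_muSubst_zero (v : LMTerm) (E : NameEnv) :
    (E.push none).muSubst 0 v = E.push (some v) := by
  funext b
  cases b <;> simp [muSubst, push]

theorem fst_muSubst (a : ℕ) (v : LMTerm) (E : NameEnv) (b : ℕ) :
    (E.muSubst a v b).1 = (E b).1 := by
  unfold muSubst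
  split <;> simp_all

theorem FreshAt.arg_muSubst {a : ℕ} {E : NameEnv} (h : E.FreshAt a) (v : LMTerm) (b : ℕ)
    (w : LMTerm) :
    (if (E b).1 = a then app ((E.arg b w).muSubst a v) v else (E.arg b w).muSubst a v) =
      (E.muSubst a v).arg b (w.muSubst a v) := by
  cases hb : (E b).2 with
  | none => by_cases ha : (E b).1 = a <;> simp [arg, muSubst, hb, ha]
  | some u =>
    obtain ⟨ha, hu⟩ := h b u hb
    simp [arg, muSubst, hb, ha, LMTerm.muSubst, muSubst_eq_self hu]

theorem FreshAt.named_muSubst {a : ℕ} {E : NameEnv} (h : E.FreshAt (a + 1)) (v : LMTerm) (b : ℕ)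
    (w : LMTerm) :
    (E.named b w).muSubst a v =
      (E.muSubst (a + 1) v.shiftMu).named b (w.muSubst (a + 1) v.shiftMu) := by
  rw [named, LMTerm.muSubst, h.arg_muSubst, named, fst_muSubst]

theorem FreshAt.contract_app_named {E : NameEnv} (h : E.FreshAt 0) (v : LMTerm) (b : ℕ)
    (w : LMTerm) :
    Contract (app (E.named b w) v)
      ((E.muSubst 0 v.shiftMu).named b (w.muSubst 0 v.shiftMu)) := by
  rw [named, named, fst_muSubst, ← h.arg_muSubst]
  exact .c2 _ _ _

theorem AppliedAt.push {a : ℕ} {E : NameEnv} (h : E.AppliedAt a) {o : Option LMTerm}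
    (ho : ∀ w, o = some w → ¬ w.MuFree (a + 1)) : (E.push o).AppliedAt (a + 1) := by
  refine ⟨?_, ?_⟩
  · rintro (_ | b) hb
    · cases hb
    · exact Option.isSome_map.trans (h.1 b (Nat.succ.inj hb))
  · rintro (_ | b) w hw
    · exact ho w hw
    · obtain ⟨u, hu, rfl⟩ := Option.map_eq_some_iff.1 hw
      exact mt muFree_shiftMu_succ.1 (h.2 b u hu)

theorem muFree_named {a b : ℕ} {E : NameEnv} {w : LMTerm} (h : (E b).1 = a + 1 ∨ w.MuFree (a + 1)) :
    (E.named b w).MuFree a := by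
  refine h.imp_right fun h => ?_
  unfold arg
  cases (E b).2 with
  | none => exact h
  | some v => exact .inl h

theorem AppliedAt.not_hasNamedLam_named {a b : ℕ} {E : NameEnv} {w : LMTerm}
    (hE : E.AppliedAt (a + 1)) (hw : ¬ w.HasNamedLam (a + 1)) :
    ¬ (E.named b w).HasNamedLam a := by
  have hb := hE.1 b
  have hv := hE.2 b
  unfold named arg
  revert hb hv
  cases (E b).2 with
  | none => exact fun hb _ => not_or.2 ⟨fun h => Bool.noConfusion (hb h.1), hw⟩
  | some v =>
    exact fun _ hv => not_or.2 ⟨And.right, not_or.2 ⟨hw, fun h => hv v rfl h.muFree⟩⟩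

theorem AppliedAt.headStep_mu_named {b : ℕ} {E : NameEnv} {w : LMTerm} (hE : E.AppliedAt 1)
    (hfree : (E b).1 = 1 ∨ w.MuFree 1) (hlam : ¬ w.HasNamedLam 1) (a : ℕ) :
    HeadStep (mu a (E.named b w)) ((E.renMu (renInst a)).named b (w.renMu (renInst a))) := by
  have hstable : (E.named b w).MuStable := ⟨muFree_named hfree, hE.not_hasNamedLam_named hlam⟩
  rw [named, named, ← arg_renMu]
  exact hstable.headStep_mu_mu a

end NameEnv

namespace IntBody

/-- The `μ`-variable `a` occurs free. -/
def MuFree : IntBody → ℕ → Prop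
  | zero, _ => False
  | succ t, a => t.MuFree a
  | mu b t, a => b = a + 1 ∨ t.MuFree (a + 1)

/-- No `μ`-variable occurs free. -/
def MuClosed (t : IntBody) : Prop := ∀ a, ¬ t.MuFree a

/-- The term obtained from a body by the substitutions `x := d`, `f := g` and by the replacement of
the names given by `E`. -/
def fill : IntBody → LMTerm → LMTerm → NameEnv → LMTerm
  | zero, d, _, _ => d
  | succ t, d, g, E => app g (t.fill d g E)
  | mu b t, d, g, E => (E.push none).named b (t.fill d.shiftMu g.shiftMu (E.push none))

/-- The body as a term, in the scope of `λxλf`. -/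
def toTerm (t : IntBody) : LMTerm := t.fill (var 1) (var 0) .id

theorem toTerm_mu (b : ℕ) (t : IntBody) : (mu b t).toTerm = LMTerm.mu b t.toTerm := by
  rw [toTerm, fill, NameEnv.push_none_id]
  rfl

theorem fill_congr (t : IntBody) (d g : LMTerm) {E E' : NameEnv}
    (h : ∀ a, t.MuFree a → E a = E' a) : t.fill d g E = t.fill d g E' := by
  induction t generalizing d g E E' with
  | zero => rfl
  | succ t ih => rw [fill, fill, ih _ _ h]
  | mu b t ih =>
    have hpush : ∀ a, b = a ∨ t.MuFree a → E.push none a = E'.push none a := by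
      rintro (_ | a) ha
      · rfl
      · rw [NameEnv.push, NameEnv.push, h a ha]
    rw [fill, fill, ih _ _ fun a ha => hpush a (.inr ha), NameEnv.named_congr (hpush b (.inl rfl))]

theorem fill_renMu (t : IntBody) (d g : LMTerm) (E : NameEnv) (r : ℕ → ℕ) :
    (t.fill d g E).renMu r = t.fill (d.renMu r) (g.renMu r) (E.renMu r) := by
  induction t generalizing d g E r with
  | zero => rfl
  | succ t ih => rw [fill, LMTerm.renMu, ih, fill]
  | mu b t ih =>
    rw [fill, NameEnv.named_renMu, ih, shiftMu_renMu, shiftMu_renMu, NameEnv.push_renMu]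
    rfl

theorem fill_subst (t : IntBody) (d g : LMTerm) (σ : ℕ → LMTerm) :
    (t.fill d g .id).subst σ = t.fill (d.subst σ) (g.subst σ) .id := by
  induction t generalizing d g σ with
  | zero => rfl
  | succ t ih => rw [fill, subst, ih, fill]
  | mu b t ih =>
    have hσ (u : LMTerm) : u.shiftMu.subst (fun x => (σ x).shiftMu) = (u.subst σ).shiftMu :=
      (renMu_subst σ Nat.succ u).symm
    rw [fill, fill, NameEnv.push_none_id, ← hσ, ← hσ, ← ih]
    rfl

theorem fill_muSubst (t : IntBody) {a : ℕ} {d g : LMTerm} {E : NameEnv} (v : LMTerm)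
    (hd : ¬ d.MuFree a) (hg : ¬ g.MuFree a) (hE : E.FreshAt a) :
    (t.fill d g E).muSubst a v = t.fill d g (E.muSubst a v) := by
  induction t generalizing a d g E v with
  | zero => exact muSubst_eq_self hd v
  | succ t ih => rw [fill, muSubst, muSubst_eq_self hg, ih v hd hg hE, fill]
  | mu b t ih =>
    rw [fill, hE.push_none.named_muSubst, ih _ (mt muFree_shiftMu_succ.1 hd)
      (mt muFree_shiftMu_succ.1 hg) hE.push_none, NameEnv.push_none_muSubst, fill]

theorem muFree_fill {t : IntBody} {a : ℕ} (h : t.MuFree a) (d g : LMTerm) (E : NameEnv) :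
    (t.fill d g E).MuFree (E a).1 := by
  induction t generalizing a d g E with
  | zero => exact h.elim
  | succ t ih => exact .inr (ih h d g E)
  | mu b t ih =>
    refine NameEnv.muFree_named (h.imp ?_ fun h => ?_)
    · rintro rfl
      rfl
    · exact ih (a := a + 1) h d.shiftMu g.shiftMu (E.push none)

theorem not_hasNamedLam_fill (t : IntBody) {a : ℕ} {d g : LMTerm} {E : NameEnv}
    (hd : ¬ d.MuFree a) (hg : ¬ g.MuFree a) (hE : E.AppliedAt a) :
    ¬ (t.fill d g E).HasNamedLam a := by
  induction t generalizing a d g E with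
  | zero => exact fun h => hd h.muFree
  | succ t ih => exact not_or.2 ⟨fun h => hg h.muFree, ih hd hg hE⟩
  | mu b t ih =>
    have hE' : (E.push none).AppliedAt (a + 1) := hE.push fun _ h => nomatch h
    exact hE'.not_hasNamedLam_named
      (ih (mt muFree_shiftMu_succ.1 hd) (mt muFree_shiftMu_succ.1 hg) hE')

theorem contract_app_fill_mu (b : ℕ) (t : IntBody) (d g v : LMTerm) (E : NameEnv) :
    Contract (app ((mu b t).fill d g E) v)
      ((E.push (some v.shiftMu)).named b
        (t.fill d.shiftMu g.shiftMu (E.push (some v.shiftMu)))) := by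
  have h := E.freshAt_push_none_zero
  have hc := h.contract_app_named v b (t.fill d.shiftMu g.shiftMu (E.push none))
  rwa [t.fill_muSubst v.shiftMu (not_muFree_shiftMu_zero d) (not_muFree_shiftMu_zero g) h,
    NameEnv.push_none_muSubst_zero] at hc

theorem MuClosed.of_toTerm {t : IntBody} {k : ℕ} (h : t.toTerm.ClosedAt k 0) : t.MuClosed :=
  fun a ha => h.not_muFree (Nat.zero_le a) (muFree_fill ha (var 1) (var 0) .id)

end IntBody

end LMTerm

namespace LMTerm

/-! ### Head reduction of integers -/

namespace IntBody

/-- The counter value at which the body reaches `x`, when it starts with the counter `j` and the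
counter saved for the name `a` is `e a`: every `f` adds `1`, and `μα[β]` saves the counter as `α`
and jumps to the one that is saved as `β`. -/
def eval : IntBody → (ℕ → ℕ) → ℕ → ℕ
  | zero, _, j => j
  | succ t, e, j => t.eval e (j + 1)
  | mu b t, e, j => t.eval (seqCons j e) (seqCons j e b)

end IntBody

/-- The term `λxλy (x)h`, where `h` does not contain `x`: the shape of `F` and `G`. -/
def passTerm (h : LMTerm) : LMTerm := lam (lam (app (var 1) h))

/-- The term `h`, with free variable `y` of index `0` under `λxλy`, turns the representation `k j`
of the counter `j` into the one of `j + 1`, and it has no other free variable. -/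
structure IsIncrement (h : LMTerm) (k : ℕ → LMTerm) : Prop where
  subst_liftSubst (σ : ℕ → LMTerm) : h.subst (liftSubst σ) = h
  shiftMu_eq : h.shiftMu = h
  inst_eq (j : ℕ) : h.inst (k j) = k (j + 1)

/-- All names have become `[0]`, and the name `a` has got the counter `e a` as argument. -/
def counterEnv (k : ℕ → LMTerm) (e : ℕ → ℕ) : NameEnv := fun a => (0, some (k (e a)).shiftMu)

/-- The term `μα[α](t)(k j)` that the reduction of a body `t` with a free name has to reach when the
counter is `j`. -/
def savedState (h d : LMTerm) (k : ℕ → LMTerm) (t : IntBody) (e : ℕ → ℕ) (j : ℕ) : LMTerm :=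
  mu 0 (app (t.fill d.shiftMu (passTerm h) (counterEnv k e)) (k j).shiftMu)

namespace IsIncrement

variable {h : LMTerm} {k : ℕ → LMTerm}

theorem not_muFree (hk : IsIncrement h k) (a : ℕ) : ¬ h.MuFree a := by
  induction a with
  | zero => exact hk.shiftMu_eq ▸ not_muFree_shiftMu_zero h
  | succ a ih => exact hk.shiftMu_eq ▸ mt muFree_shiftMu_succ.1 ih

theorem shiftMu_passTerm (hk : IsIncrement h k) : (passTerm h).shiftMu = passTerm h :=
  congrArg (fun u => lam (lam (app (var 1) u))) hk.shiftMu_eq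

theorem not_muFree_passTerm (hk : IsIncrement h k) (a : ℕ) : ¬ (passTerm h).MuFree a :=
  not_or.2 ⟨id, hk.not_muFree a⟩

theorem headStep_passTerm (hk : IsIncrement h k) (u : LMTerm) :
    HeadStep (app (passTerm h) u) (lam (app u.shiftLam h)) := by
  have hs := headStep_beta (lam (app (var 1) h)) u
  rwa [inst, subst, subst, hk.subst_liftSubst] at hs

theorem headStep_lam_app (h u v : LMTerm) :
    HeadStep (app (lam (app u.shiftLam h)) v) (app u (h.inst v)) := by
  have hs := headStep_beta (app u.shiftLam h) v
  rwa [inst, subst, ← inst, ← inst, inst_shiftLam] at hs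

theorem headRed_passTerm (hk : IsIncrement h k) (u : LMTerm) (j : ℕ) :
    HeadRed (app (app (passTerm h) u) (k j)) (app u (k (j + 1))) :=
  .head ((hk.headStep_passTerm u).app_app (k j))
    (.single (hk.inst_eq j ▸ headStep_lam_app h u (k j)))

theorem headRed_mu_passTerm (hk : IsIncrement h k) {u : LMTerm} (hu : u.MuStable) (j : ℕ) :
    HeadRed (mu 0 (app (app (passTerm h) u) (k j).shiftMu)) (mu 0 (app u (k (j + 1)).shiftMu)) := by
  have hv := not_muFree_shiftMu_zero (k j)
  have hinst : h.inst (k j).shiftMu = (k (j + 1)).shiftMu := by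
    rw [← hk.inst_eq, shiftMu_inst, hk.shiftMu_eq]
  exact .head (((hk.headStep_passTerm u).app_app _).mu_app
      ((hu.app_right (hk.not_muFree_passTerm 0)).app_left hv) 0)
    (.single (hinst ▸ (headStep_lam_app h u _).mu_app
      ((hu.shiftLam.app_left (hk.not_muFree 0)).lam.app_left hv) 0))

end IsIncrement

theorem appliedAt_counterEnv (k : ℕ → LMTerm) (e : ℕ → ℕ) : (counterEnv k e).AppliedAt 0 :=
  ⟨fun _ _ => rfl, by rintro _ _ ⟨⟩; exact not_muFree_shiftMu_zero _⟩

theorem counterEnv_push_renMu (k : ℕ → LMTerm) (e : ℕ → ℕ) (j : ℕ) :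
    ((counterEnv k e).push (some (k j).shiftMu.shiftMu)).renMu (renInst 0) =
      counterEnv k (seqCons j e) := by
  funext a
  cases a <;>
    simp only [NameEnv.renMu, NameEnv.push, counterEnv, seqCons, Option.map_some,
      shiftMu_renMu_renInst, renInst]

namespace IsIncrement

variable {h : LMTerm} {k : ℕ → LMTerm} {t : IntBody} {b : ℕ}

theorem headStep_app_fill_mu (hk : IsIncrement h k) (ht : (IntBody.mu b t).MuClosed) (d : LMTerm)
    (e : ℕ → ℕ) (j : ℕ) :
    HeadStep (app ((IntBody.mu b t).fill d (passTerm h) .id) (k j))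
      (savedState h d k t (seqCons j e) (seqCons j e b)) := by
  have hE : ∀ a, b = a ∨ t.MuFree a →
      NameEnv.id.push (some (k j).shiftMu) a = counterEnv k (seqCons j e) a := by
    rintro (_ | a) ha
    · rfl
    · exact (ht a ha).elim
  have hs := (IntBody.contract_app_fill_mu b t d (passTerm h) (k j) .id).headStep
  rwa [NameEnv.named_congr (hE b (.inl rfl)), t.fill_congr _ _ fun a ha => hE a (.inr ha),
    hk.shiftMu_passTerm] at hs

theorem headStep_savedState (hk : IsIncrement h k) (ht : t.MuClosed) (d : LMTerm) (e : ℕ → ℕ)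
    (j : ℕ) :
    HeadStep (savedState h d k t e j) (app (t.fill d (passTerm h) .id) (k j)) := by
  have hshift : t.fill d.shiftMu (passTerm h) (counterEnv k e) =
      (t.fill d (passTerm h) .id).shiftMu := by
    rw [shiftMu, shiftMu, IntBody.fill_renMu, ← shiftMu, ← shiftMu, hk.shiftMu_passTerm]
    exact t.fill_congr _ _ fun a ha => (ht a ha).elim
  rw [savedState, hshift]
  exact (Contract.s2 (app (t.fill d (passTerm h) .id) (k j))).headStep

theorem muStable_fill (hk : IsIncrement h k) {a : ℕ} (ht : t.MuFree a) (d : LMTerm) (e : ℕ → ℕ) :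
    (t.fill d.shiftMu (passTerm h) (counterEnv k e)).MuStable :=
  ⟨IntBody.muFree_fill ht _ _ (counterEnv k e),
    t.not_hasNamedLam_fill (not_muFree_shiftMu_zero d) (hk.not_muFree_passTerm 0)
      (appliedAt_counterEnv k e)⟩

theorem headRed_savedState_succ (hk : IsIncrement h k) {a : ℕ} (ht : t.MuFree a) (d : LMTerm)
    (e : ℕ → ℕ) (j : ℕ) :
    HeadRed (savedState h d k (.succ t) e j) (savedState h d k t e (j + 1)) :=
  hk.headRed_mu_passTerm (hk.muStable_fill ht d e) j

/-- The inner `μ` absorbs the counter by `(C₂)` and is then merged with the outer one by `(S₁)`. -/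
theorem headRed_savedState_mu (hk : IsIncrement h k) {a : ℕ} (ht : (IntBody.mu b t).MuFree a)
    (d : LMTerm) (e : ℕ → ℕ) (j : ℕ) :
    HeadRed (savedState h d k (.mu b t) e j)
      (savedState h d k t (seqCons j e) (seqCons j e b)) := by
  set E := (counterEnv k e).push (some (k j).shiftMu.shiftMu) with hE
  set w := t.fill d.shiftMu.shiftMu (passTerm h).shiftMu E with hw
  have happlied : E.AppliedAt 1 := (appliedAt_counterEnv k e).push <| by
    rintro _ ⟨⟩
    exact mt muFree_shiftMu_succ.1 (not_muFree_shiftMu_zero (k j))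
  have hlam : ¬ w.HasNamedLam 1 :=
    t.not_hasNamedLam_fill (mt muFree_shiftMu_succ.1 (not_muFree_shiftMu_zero d))
      (mt muFree_shiftMu_succ.1 (hk.not_muFree_passTerm 0)) happlied
  have hfree : (E b).1 = 1 ∨ w.MuFree 1 :=
    Or.imp (congrArg fun c => (E c).1) (fun h' => IntBody.muFree_fill (a := a + 1) h' _ _ E) ht
  have habsorb : HeadStep (savedState h d k (.mu b t) e j) (mu 0 (E.named b w)) :=
    (IntBody.contract_app_fill_mu b t d.shiftMu (passTerm h) (k j).shiftMu
      (counterEnv k e)).headStep.mu_app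
        ((hk.muStable_fill ht d e).app_left (not_muFree_shiftMu_zero _)) 0
  have hmerge := happlied.headStep_mu_named hfree hlam 0
  rw [hw, IntBody.fill_renMu, shiftMu_renMu_renInst, shiftMu_renMu_renInst, hE,
    counterEnv_push_renMu] at hmerge
  exact .head habsorb (.single hmerge)

theorem headRed_app_fill (hk : IsIncrement h k) (d : LMTerm) (t : IntBody) :
    (t.MuClosed → ∀ e j,
      HeadRed (app (t.fill d (passTerm h) .id) (k j)) (app d (k (t.eval e j)))) ∧
    ∀ e j, HeadRed (savedState h d k t e j) (app d (k (t.eval e j))) := by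
  induction t with
  | zero =>
    have hclosed : IntBody.zero.MuClosed := fun _ => id
    exact ⟨fun _ _ _ => .refl, fun e j => .single (hk.headStep_savedState hclosed d e j)⟩
  | succ t ih =>
    have happ (ht : t.MuClosed) (e : ℕ → ℕ) (j : ℕ) :
        HeadRed (app ((IntBody.succ t).fill d (passTerm h) .id) (k j))
          (app d (k (t.eval e (j + 1)))) :=
      (hk.headRed_passTerm _ j).trans (ih.1 ht e (j + 1))
    refine ⟨happ, fun e j => ?_⟩
    by_cases ht : t.MuClosed
    · exact .head (hk.headStep_savedState (t := .succ t) ht d e j) (happ ht e j)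
    · obtain ⟨a, ha⟩ := not_forall_not.1 ht
      exact (hk.headRed_savedState_succ ha d e j).trans (ih.2 e (j + 1))
  | mu b t ih =>
    have happ (ht : (IntBody.mu b t).MuClosed) (e : ℕ → ℕ) (j : ℕ) :
        HeadRed (app ((IntBody.mu b t).fill d (passTerm h) .id) (k j))
          (app d (k (t.eval (seqCons j e) (seqCons j e b)))) :=
      .head (hk.headStep_app_fill_mu ht d e j) (ih.2 _ _)
    refine ⟨happ, fun e j => ?_⟩
    by_cases ht : (IntBody.mu b t).MuClosed
    · exact .head (hk.headStep_savedState ht d e j) (happ ht e j)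
    · obtain ⟨a, ha⟩ := not_forall_not.1 ht
      exact (hk.headRed_savedState_mu ha d e j).trans (ih.2 _ _)

theorem headRed_integer (hk : IsIncrement h k) (ht : t.MuClosed) (d : LMTerm) :
    HeadRed (app (app (app (lam (lam t.toTerm)) d) (passTerm h)) (k 0))
      (app d (k (t.eval (fun _ => 0) 0))) := by
  have hx : HeadStep (app (lam (lam t.toTerm)) d) (lam (t.fill d.shiftLam (var 0) .id)) := by
    have hs := headStep_beta (lam t.toTerm) d
    rwa [inst, subst, IntBody.toTerm, IntBody.fill_subst] at hs
  have hf : HeadStep (app (lam (t.fill d.shiftLam (var 0) .id)) (passTerm h))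
      (t.fill d (passTerm h) .id) := by
    have hs := headStep_beta (t.fill d.shiftLam (var 0) .id) (passTerm h)
    rwa [inst, IntBody.fill_subst, ← inst, inst_shiftLam] at hs
  exact .head ((hx.app_app _).app_app _)
    (.head (hf.app_app _) ((hk.headRed_app_fill d t).1 ht _ 0))

end IsIncrement

end LMTerm

/-! ### An abstract machine -/

mutual

/-- Closures of the abstract machine: a term with a closure for every `λ`-variable and a stack for
every `μ`-variable, or one of the two constants by which a counting term is run, `delta` in place of
`x` and `succ` in place of `f`. -/
inductive Closure : Type
  | delta : Closure
  | succ : Closure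
  | clo (t : LMTerm) (ρ : ℕ → Closure) (e : ℕ → Stack) : Closure

/-- Stacks of the abstract machine: finitely many arguments on top of a counter. -/
inductive Stack : Type
  | num (j : ℕ) : Stack
  | cons (c : Closure) (π : Stack) : Stack

end

/-- `Run M c π`: the machine started with the closure `c` and the stack `π` calls `delta` on a
counter that belongs to `M`. -/
inductive Run (M : Set ℕ) : Closure → Stack → Prop
  | delta {j : ℕ} (h : j ∈ M) : Run M .delta (.num j)
  | succ {c : Closure} {j : ℕ} (h : Run M c (.num (j + 1))) : Run M .succ (.cons c (.num j))
  | var {x : ℕ} {ρ : ℕ → Closure} {e : ℕ → Stack} {π : Stack} (h : Run M (ρ x) π) :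
      Run M (.clo (.var x) ρ e) π
  | lam {t : LMTerm} {ρ : ℕ → Closure} {e : ℕ → Stack} {c : Closure} {π : Stack}
      (h : Run M (.clo t (seqCons c ρ) e) π) : Run M (.clo (.lam t) ρ e) (.cons c π)
  | app {t s : LMTerm} {ρ : ℕ → Closure} {e : ℕ → Stack} {π : Stack}
      (h : Run M (.clo t ρ e) (.cons (.clo s ρ e) π)) : Run M (.clo (.app t s) ρ e) π
  | mu {b : ℕ} {t : LMTerm} {ρ : ℕ → Closure} {e : ℕ → Stack} {π : Stack}
      (h : Run M (.clo t ρ (seqCons π e)) (seqCons π e b)) : Run M (.clo (.mu b t) ρ e) π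

namespace LMTerm

theorem Normal.of_lam {t : LMTerm} (h : (lam t).Normal) : t.Normal := fun _ h' => h _ (.lam h')

theorem Normal.of_app_left {t s : LMTerm} (h : (app t s).Normal) : t.Normal :=
  fun _ h' => h _ (.appL _ h')

theorem Normal.of_app_right {t s : LMTerm} (h : (app t s).Normal) : s.Normal :=
  fun _ h' => h _ (.appR _ h')

theorem Normal.of_mu {b : ℕ} {t : LMTerm} (h : (mu b t).Normal) : t.Normal :=
  fun _ h' => h _ (.mu _ h')

theorem not_normal_app_lam (t s : LMTerm) : ¬ (app (lam t) s).Normal :=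
  fun h => h _ (.root (.c1 t s))

theorem not_normal_app_mu (b : ℕ) (t s : LMTerm) : ¬ (app (mu b t) s).Normal :=
  fun h => h _ (.root (.c2 b t s))

end LMTerm

open LMTerm

section Machine

variable {M : Set ℕ}

theorem not_run_cons_cons {c d d' : Closure} {π : Stack} (hc : c = .delta ∨ c = .succ) :
    ¬ Run M c (.cons d (.cons d' π)) := by
  rcases hc with rfl | rfl <;> rintro ⟨⟩

theorem not_run_app_cons {t s : LMTerm} {ρ : ℕ → Closure} {e : ℕ → Stack} {c : Closure} {π : Stack}
    (hρ : ∀ x, ρ x = .delta ∨ ρ x = .succ) (ht : (app t s).Normal) :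
    ¬ Run M (.clo (app t s) ρ e) (.cons c π) := by
  induction t generalizing s c π with
  | var x =>
    intro h
    cases h with | app h => cases h with | var h => exact not_run_cons_cons (hρ x) h
  | lam t => exact (not_normal_app_lam _ _ ht).elim
  | app t u iht _ =>
    rintro (_ | _ | _ | _ | ⟨h⟩)
    exact iht ht.of_app_left h
  | mu b t => exact (not_normal_app_mu _ _ _ ht).elim

theorem not_run_var_cons {x : ℕ} {ρ : ℕ → Closure} {e : ℕ → Stack} {c : Closure} {π : Stack}
    (hx : ρ x = .delta) : ¬ Run M (.clo (var x) ρ e) (.cons c π) := by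
  rintro (_ | _ | ⟨h⟩)
  rw [hx] at h
  cases h

theorem exists_eq_lam_of_run {k : ℕ} {t : LMTerm} {ρ : ℕ → Closure} {e : ℕ → Stack} {c : Closure}
    {π : Stack} (hρ : ∀ x, ρ x = .delta) (ht : t.Normal) (hc : t.ClosedAt k 0)
    (h : Run M (.clo t ρ e) (.cons c π)) :
    ∃ u, t = lam u ∧ Run M (.clo u (seqCons c ρ) e) π := by
  have happ {t s : LMTerm} {e : ℕ → Stack} (ht : (app t s).Normal) :
      ¬ Run M (.clo (app t s) ρ e) (.cons c π) := not_run_app_cons (fun x => .inl (hρ x)) ht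
  cases t with
  | var x => exact (not_run_var_cons (hρ x) h).elim
  | lam t => cases h with | lam h => exact ⟨t, rfl, h⟩
  | app t s => exact (happ ht h).elim
  | mu b t =>
    obtain rfl : b = 0 := Nat.lt_one_iff.1 hc.1
    cases h with
    | mu h =>
      cases t with
      | var x => exact (not_run_var_cons (hρ x) h).elim
      | lam t => exact (ht _ (.root (.s3 0 (lam t) (.inl ⟨rfl, trivial⟩)))).elim
      | app t s => exact (happ ht.of_mu h).elim
      | mu b t => exact (ht _ (.named (.s1 0 b t))).elim

/-- The closures of the variables in the body of `λxλf t`, the other indices being irrelevant. -/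
def bodyEnv : ℕ → Closure := seqCons .succ fun _ => .delta

theorem bodyEnv_eq (x : ℕ) : bodyEnv x = .delta ∨ bodyEnv x = .succ := by
  cases x
  exacts [.inr rfl, .inl rfl]

theorem seqCons_num (j : ℕ) (e : ℕ → ℕ) :
    seqCons (.num j) (fun a => .num (e a)) = fun a => Stack.num (seqCons j e a) := by
  funext a
  cases a <;> rfl

theorem exists_eq_toTerm_of_run {t : LMTerm} {m j : ℕ} {e : ℕ → ℕ} (ht : t.Normal)
    (hc : t.ClosedAt 2 m) (h : Run M (.clo t bodyEnv fun a => .num (e a)) (.num j)) :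
    ∃ u : IntBody, t = u.toTerm ∧ u.eval e j ∈ M := by
  induction t generalizing m e j with
  | var x =>
    obtain _ | _ | ⟨h⟩ := h
    obtain _ | _ | x := x
    · cases h
    · cases h with | delta h => exact ⟨.zero, rfl, h⟩
    · exact absurd hc (Nat.not_lt.2 (Nat.le_add_left 2 x))
  | lam t => cases h
  | app t s _ ihs =>
    obtain _ | _ | _ | _ | ⟨h⟩ := h
    cases t with
    | var x =>
      obtain _ | _ | ⟨h⟩ := h
      cases x with
      | zero =>
        cases h with
        | succ h =>
          obtain ⟨u, rfl, hu⟩ := ihs ht.of_app_right hc.2 h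
          exact ⟨.succ u, rfl, hu⟩
      | succ x => cases h
    | lam t => exact (not_normal_app_lam _ _ ht).elim
    | app t u => exact (not_run_app_cons bodyEnv_eq ht.of_app_left h).elim
    | mu b t => exact (not_normal_app_mu _ _ _ ht).elim
  | mu b t ih =>
    obtain _ | _ | _ | _ | _ | ⟨h⟩ := h
    rw [seqCons_num] at h
    obtain ⟨u, rfl, hu⟩ := ih ht.of_mu hc.2 h
    exact ⟨.mu b u, (u.toTerm_mu b).symm, hu⟩

theorem exists_eq_lam_lam_of_run {θ : LMTerm} (hnormal : θ.Normal) (hclosed : θ.Closed)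
    (h : Run M (.clo θ (fun _ => .delta) fun _ => .num 0) (.cons .delta (.cons .succ (.num 0)))) :
    ∃ u : IntBody, θ = lam (lam u.toTerm) ∧ u.MuClosed ∧ u.eval (fun _ => 0) 0 ∈ M := by
  have hδ : seqCons .delta (fun _ => .delta) = fun _ => Closure.delta := by
    funext x
    cases x <;> rfl
  obtain ⟨t, rfl, ht⟩ := exists_eq_lam_of_run (fun _ => rfl) hnormal hclosed h
  rw [hδ] at ht
  obtain ⟨u, rfl, hu⟩ := exists_eq_lam_of_run (k := 1) (fun _ => rfl) hnormal.of_lam hclosed ht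
  obtain ⟨u, rfl, hM⟩ := exists_eq_toTerm_of_run (m := 0) hnormal.of_lam.of_lam hclosed hu
  exact ⟨u, rfl, .of_toTerm (k := 2) hclosed, hM⟩

end Machine

/-! ### Realizability -/

section Realizability

open FirstOrder Language

variable {L : FirstOrder.Language.{u, v}} {E : Set (L.Term ℕ × L.Term ℕ)}

/-- The structure `D` is a model of the set `E` of universally quantified equations. -/
def SatisfiesEqs (E : Set (L.Term ℕ × L.Term ℕ)) (D : Type*) [L.Structure D] : Prop :=
  ∀ a b : L.Term ℕ, (a, b) ∈ E → ∀ v : ℕ → D, a.realize v = b.realize v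

theorem EqConseq.realize_eq {D : Type*} [L.Structure D] (hD : SatisfiesEqs E D) {a b : L.Term ℕ}
    (h : EqConseq E a b) (v : ℕ → D) : a.realize v = b.realize v := by
  induction h with
  | ax h σ =>
    rw [Term.realize_subst, Term.realize_subst]
    exact hD _ _ h _
  | refl a => rfl
  | symm _ ih => exact ih.symm
  | trans _ _ ih ih' => exact ih.trans ih'
  | func f _ ih => exact congrArg (Structure.funMap f) (funext ih)

theorem subst_termVar {α : Type*} (t : L.Term α) : t.subst Term.var = t := by
  induction t with
  | var x => rfl
  | func f ts ih => exact congrArg (Term.func f) (funext ih)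

namespace EqConseq

variable (E)

/-- Provable equality of individual terms, whose quotient is the term model of `E`. -/
def setoid : Setoid (L.Term ℕ) where
  r := EqConseq E
  iseqv := ⟨.refl, .symm, .trans⟩

/-- The structure of the term model. The relation symbols are irrelevant for realizability, and no
relation holds. -/
instance : L.Prestructure (setoid E) where
  toStructure := { funMap := Term.func, RelMap := fun _ _ => False }
  fun_equiv _ _ h := .func _ h
  rel_equiv _ _ _ := rfl

theorem realize_mk (σ : ℕ → L.Term ℕ) (t : L.Term ℕ) :
    t.realize (fun x => Quotient.mk (setoid E) (σ x)) = Quotient.mk (setoid E) (t.subst σ) := by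
  induction t with
  | var x => rfl
  | func f ts ih =>
    rw [Term.realize_func, funext ih, funMap_quotient_mk']
    rfl

theorem satisfiesEqs_quotient : SatisfiesEqs E (Quotient (setoid E)) := by
  intro a b hab v
  obtain ⟨σ, rfl⟩ : ∃ σ : ℕ → L.Term ℕ, v = fun x => Quotient.mk (setoid E) (σ x) :=
    ⟨fun x => (v x).out, funext fun x => (v x).out_eq.symm⟩
  rw [realize_mk, realize_mk]
  exact Quotient.sound (.ax hab σ)

end EqConseq

namespace SOForm

open LMTerm

variable {M : Set ℕ} {D : Type*}

/-- Values of the relation variables: for every arity, relations on `D` with values in the sets of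
stacks. -/
abbrev RelVal (D : Type*) : Type _ := (k : ℕ) → ℕ → (Fin k → D) → Set Stack

/-- Extension of a valuation by a value for the relation variable `0` of arity `k`; the other
relation variables of arity `k` move up by one. -/
def RelVal.cons {k : ℕ} (P : (Fin k → D) → Set Stack) (V : RelVal D) : RelVal D := fun j X =>
  if h : j = k then
    match X with
    | 0 => fun ds => P fun i => ds (Fin.cast h.symm i)
    | X + 1 => V j X
  else V j X

/-- The closures that run with every stack of a set: the truth value given by a falsity value. -/
def orth (M : Set ℕ) (S : Set Stack) : Set Closure := {c | ∀ π ∈ S, Run M c π}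

variable [L.Structure D]

/-- The falsity value of a formula: the stacks against which its realizers have to run. The typing
rules say nothing about `⊥` and about the relation symbols, whose value could be any set. -/
def falsity (M : Set ℕ) : SOForm L → (ℕ → D) → RelVal D → Set Stack
  | bot, _, _ => ∅
  | rel _ _, _, _ => ∅
  | rvar k X ts, v, V => V k X fun i => (ts i).realize v
  | imp A B, v, V => {π | ∃ c ∈ orth M (falsity M A v V), ∃ π' ∈ falsity M B v V, π = .cons c π'}
  | all1 A, v, V => {π | ∃ d, π ∈ falsity M A (seqCons d v) V}
  | all2 k A, v, V => {π | ∃ P : (Fin k → D) → Set Stack, π ∈ falsity M A v (V.cons P)}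

theorem falsity_subst1 (A : SOForm L) (σ : ℕ → L.Term ℕ) (v : ℕ → D) (V : RelVal D) :
    falsity M (A.subst1 σ) v V = falsity M A (fun x => (σ x).realize v) V := by
  induction A generalizing σ v V with
  | bot => rfl
  | rel R ts => rfl
  | rvar k X ts => simp only [subst1, falsity, Term.realize_subst]
  | imp A B ihA ihB => simp only [subst1, falsity, ihA, ihB]
  | all1 A ih =>
    simp only [subst1, falsity, ih]
    congr! 6 with d
    funext x
    cases x with
    | zero => rfl
    | succ x => simp only [lift1, Term.realize_relabel, seqCons]; rfl
  | all2 k A ih => simp only [subst1, falsity, ih]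

theorem falsity_shift1 (A : SOForm L) (d : D) (v : ℕ → D) (V : RelVal D) :
    falsity M A.shift1 (seqCons d v) V = falsity M A v V :=
  falsity_subst1 A _ _ V

theorem falsity_inst1 (A : SOForm L) (a : L.Term ℕ) (v : ℕ → D) (V : RelVal D) :
    falsity M (A.inst1 a) v V = falsity M A (seqCons (a.realize v) v) V := by
  rw [inst1, falsity_subst1]
  congr 1
  funext x
  cases x <;> rfl

theorem falsity_ren2 (A : SOForm L) (r : ℕ → ℕ → ℕ) (v : ℕ → D) (V : RelVal D) :
    falsity M (A.ren2 r) v V = falsity M A v fun k X => V k (r k X) := by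
  induction A generalizing r v V with
  | bot => rfl
  | rel R ts => rfl
  | rvar k X ts => rfl
  | imp A B ihA ihB => simp only [ren2, falsity, ihA, ihB]
  | all1 A ih => simp only [ren2, falsity, ih]
  | all2 k A ih =>
    simp only [ren2, falsity, ih]
    congr! 6 with P
    funext j X
    by_cases h : j = k
    · subst h
      cases X <;> simp [RelVal.cons, liftRen2, LMTerm.liftRen]
    · simp [RelVal.cons, liftRen2, h]

theorem falsity_shift2 (A : SOForm L) {k : ℕ} (P : (Fin k → D) → Set Stack) (v : ℕ → D)
    (V : RelVal D) : falsity M (A.shift2 k) v (V.cons P) = falsity M A v V := by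
  rw [shift2, falsity_ren2]
  congr 1
  funext j X
  by_cases h : j = k
  · subst h
    simp [RelVal.cons]
  · simp [RelVal.cons, h]

/-- Values of the individual variables of a formula with `k` parameters. -/
def argVal {k : ℕ} (ds : Fin k → D) (v : ℕ → D) (x : ℕ) : D :=
  if h : x < k then ds ⟨x, h⟩ else v (x - k)

theorem realize_args {k : ℕ} (ts : Fin k → L.Term ℕ) (v : ℕ → D) (x : ℕ) :
    (args ts x).realize v = argVal (fun i => (ts i).realize v) v x := by
  unfold args argVal
  split <;> rfl

theorem falsity_rvarAbs (k X : ℕ) (ds : Fin k → D) (v : ℕ → D) (V : RelVal D) :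
    falsity M (rvarAbs k X : SOForm L) (argVal ds v) V = V k X ds := by
  simp [rvarAbs, falsity, argVal]

theorem falsity_subst2 (A : SOForm L) (τ : ℕ → ℕ → SOForm L) (v : ℕ → D) (V : RelVal D) :
    falsity M (A.subst2 τ) v V =
      falsity M A v fun k X ds => falsity M (τ k X) (argVal ds v) V := by
  induction A generalizing τ v V with
  | bot => rfl
  | rel R ts => rfl
  | rvar k X ts => simp only [subst2, falsity, falsity_subst1, realize_args]
  | imp A B ihA ihB => simp only [subst2, falsity, ihA, ihB]
  | all1 A ih =>
    simp only [subst2, falsity, ih, falsity_subst1]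
    congr! 6 with d
    funext k X ds
    congr 1
    funext x
    by_cases h : x < k
    · simp [argVal, h]
    · have hx : x + 1 - k = (x - k) + 1 := by omega
      have h' : ¬ x + 1 < k := by omega
      simp [argVal, h, h', hx, seqCons]
  | all2 k A ih =>
    simp only [subst2, falsity, ih]
    congr! 6 with P
    funext j X ds
    by_cases h : j = k
    · subst h
      cases X with
      | zero => simp [falsity_rvarAbs, RelVal.cons]
      | succ X => simp [falsity_shift2, RelVal.cons]
    · simp [h, falsity_shift2, RelVal.cons]

theorem falsity_inst2 (A : SOForm L) (k : ℕ) (G : SOForm L) (v : ℕ → D) (V : RelVal D) :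
    falsity M (A.inst2 k G) v V =
      falsity M A v (V.cons fun ds : Fin k → D => falsity M G (argVal ds v) V) := by
  rw [inst2, falsity_subst2]
  congr 1
  funext j X ds
  by_cases h : j = k
  · subst h
    cases X <;> simp [falsity_rvarAbs, RelVal.cons]
  · simp [h, falsity_rvarAbs, RelVal.cons]

end SOForm

variable {M : Set ℕ} {D : Type*} [L.Structure D]

open LMTerm SOForm

theorem forall_getElem?_cons {α : Type*} {a : α} {l : List α} {p : ℕ → α → Prop} (ha : p 0 a)
    (h : ∀ i b, l[i]? = some b → p (i + 1) b) (i : ℕ) (b : α) (hb : (a :: l)[i]? = some b) :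
    p i b := by
  cases i with
  | zero =>
    cases hb
    exact ha
  | succ i => exact h i b hb

theorem forall_getElem?_map {α β : Type*} {f : α → β} {l : List α} {p : ℕ → β → Prop}
    (h : ∀ i a, l[i]? = some a → p i (f a)) (i : ℕ) (b : β) (hb : (l.map f)[i]? = some b) :
    p i b := by
  obtain ⟨a, ha, rfl⟩ := Option.map_eq_some_iff.1 (List.getElem?_map ▸ hb)
  exact h i a ha

theorem Typing.mem_orth (hD : SatisfiesEqs E D) {Γ Δ : List (SOForm L)} {t : LMTerm} {A : SOForm L}
    (h : Typing E Γ t A Δ) (v : ℕ → D) (V : RelVal D) {ρ : ℕ → Closure} {e : ℕ → Stack}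
    (hρ : ∀ x B, Γ[x]? = some B → ρ x ∈ orth M (falsity M B v V))
    (he : ∀ a B, Δ[a]? = some B → e a ∈ falsity M B v V) :
    .clo t ρ e ∈ orth M (falsity M A v V) := by
  induction h generalizing v V ρ e with
  | ax h => exact fun π hπ => .var (hρ _ _ h π hπ)
  | lam _ ih =>
    rintro _ ⟨c, hc, π, hπ, rfl⟩
    exact .lam (ih v V (forall_getElem?_cons hc hρ) he π hπ)
  | app _ _ ih ih' => exact fun π hπ => .app (ih v V hρ he _ ⟨_, ih' v V hρ he, π, hπ, rfl⟩)
  | all1I _ ih =>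
    rintro π ⟨d, hπ⟩
    refine ih (seqCons d v) V (forall_getElem?_map ?_) (forall_getElem?_map ?_) π hπ
    · exact fun x B hB => (falsity_shift1 B _ v V).symm ▸ hρ x B hB
    · exact fun x B hB => (falsity_shift1 B _ v V).symm ▸ he x B hB
  | all1E a _ ih =>
    rw [falsity_inst1]
    exact fun π hπ => ih v V hρ he π ⟨_, hπ⟩
  | all2I _ ih =>
    rintro π ⟨P, hπ⟩
    refine ih v (V.cons P) (forall_getElem?_map ?_) (forall_getElem?_map ?_) π hπ
    · exact fun x B hB => (falsity_shift2 B _ v V).symm ▸ hρ x B hB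
    · exact fun x B hB => (falsity_shift2 B _ v V).symm ▸ he x B hB
  | all2E G _ ih =>
    rw [falsity_inst2]
    exact fun π hπ => ih v V hρ he π ⟨_, hπ⟩
  | eq hab _ ih =>
    rw [falsity_inst1, ← hab.realize_eq hD, ← falsity_inst1]
    exact ih v V hρ he
  | mu hb _ ih =>
    intro π hπ
    have he' := forall_getElem?_cons (p := fun a B => seqCons π e a ∈ falsity M B v V) hπ he
    exact .mu (ih v V hρ he' _ (he' _ _ hb))

section Integers

variable {zero : L.Functions 0} {succ : L.Functions 1}

theorem realize_numeral (v : ℕ → D) (n : ℕ) :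
    (numeral zero succ n).realize v =
      (fun d => Structure.funMap succ ![d])^[n] (Structure.funMap zero ![]) := by
  induction n with
  | zero => exact congrArg (Structure.funMap zero) (Subsingleton.elim _ _)
  | succ n ih =>
    rw [numeral, Function.iterate_succ_apply', Function.iterate_succ_apply', ← ih]
    exact Term.realize_functions_apply₁

theorem IsClassicalInteger.run_of_satisfiesEqs {n : ℕ} {θ : LMTerm}
    (hθ : IsClassicalInteger zero succ E n θ) (hD : SatisfiesEqs E D) (v : ℕ → D)
    (ρ : ℕ → Closure) (e : ℕ → Stack) :
    Run {m | (numeral zero succ m).realize v = (numeral zero succ n).realize v}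
      (.clo θ ρ e) (.cons .delta (.cons .succ (.num 0))) := by
  let s : D → D := fun d => Structure.funMap succ ![d]
  let P : (Fin 1 → D) → Set Stack := fun ds =>
    {π | ∃ j, π = .num j ∧ s^[j] (ds 0) = (numeral zero succ n).realize v}
  refine hθ.2.mem_orth hD v (fun _ _ _ => ∅) (by simp) (by simp) _
    ⟨P, .delta, ?_, _, ⟨.succ, ?_, .num 0, ⟨0, rfl, rfl⟩, rfl⟩, rfl⟩
  · rintro _ ⟨j, rfl, hj⟩
    refine .delta (Eq.trans ?_ hj)
    rw [realize_numeral]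
    exact congrArg s^[j] (realize_numeral (succ := succ) v 0).symm
  · rintro _ ⟨d, c, hc, _, ⟨j, rfl, hj⟩, rfl⟩
    refine .succ (hc _ ⟨j + 1, rfl, Eq.trans ?_ hj⟩)
    rw [Function.iterate_succ_apply]
    exact congrArg s^[j] Term.realize_functions_apply₁.symm

theorem IsClassicalInteger.run {n : ℕ} {θ : LMTerm} (hθ : IsClassicalInteger zero succ E n θ)
    (ρ : ℕ → Closure) (e : ℕ → Stack) :
    Run {m | EqConseq E (numeral zero succ m) (numeral zero succ n)}
      (.clo θ ρ e) (.cons .delta (.cons .succ (.num 0))) := by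
  have h := hθ.run_of_satisfiesEqs (EqConseq.satisfiesEqs_quotient E)
    (fun x => Quotient.mk (EqConseq.setoid E) (.var x)) ρ e
  simp only [EqConseq.realize_mk, subst_termVar, Quotient.eq] at h
  exact h

theorem Adequate.eq_of_numeral (hE : Adequate zero succ E) {m n : ℕ}
    (h : EqConseq E (numeral zero succ m) (numeral zero succ n)) : m = n := by
  induction m generalizing n with
  | zero =>
    cases n with
    | zero => rfl
    | succ n =>
      rw [numeral, numeral, Function.iterate_succ_apply'] at h
      exact (hE.1 _ h.symm).elim
  | succ m ih =>
    cases n with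
    | zero =>
      rw [numeral, numeral, Function.iterate_succ_apply'] at h
      exact (hE.1 _ h).elim
    | succ n =>
      rw [numeral, numeral, Function.iterate_succ_apply', Function.iterate_succ_apply'] at h
      exact congrArg Nat.succ (ih (hE.2 _ _ h))

end Integers

end Realizability

namespace LMTerm

/-! ### Church integers -/

theorem Red.lam {t t' : LMTerm} (h : Red t t') : Red (lam t) (lam t') :=
  h.lift _ fun _ _ => .lam

theorem Red.app_left {t t' : LMTerm} (h : Red t t') (s : LMTerm) : Red (app t s) (app t' s) :=
  h.lift (app · s) fun _ _ => .appL s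

theorem Red.app_right (t : LMTerm) {s s' : LMTerm} (h : Red s s') : Red (app t s) (app t s') :=
  h.lift _ fun _ _ => .appR t

theorem red_beta (t v : LMTerm) : Red (app (lam t) v) (t.inst v) :=
  .single (.root (.c1 t v))

theorem iterApp_succ (s t : LMTerm) (n : ℕ) : iterApp s (n + 1) t = app s (iterApp s n t) :=
  Function.iterate_succ_apply' _ _ _

theorem subst_iterApp (s t : LMTerm) (σ : ℕ → LMTerm) (n : ℕ) :
    (iterApp s n t).subst σ = iterApp (s.subst σ) n (t.subst σ) := by
  induction n with
  | zero => rfl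
  | succ n ih => rw [iterApp_succ, iterApp_succ, subst, ih]

theorem renLam_iterApp (s t : LMTerm) (r : ℕ → ℕ) (n : ℕ) :
    (iterApp s n t).renLam r = iterApp (s.renLam r) n (t.renLam r) := by
  induction n with
  | zero => rfl
  | succ n ih => rw [iterApp_succ, iterApp_succ, renLam, ih]

theorem shiftLam_church (n : ℕ) : (church n).shiftLam = church n := by
  rw [church, shiftLam, renLam, renLam, renLam_iterApp]
  rfl

theorem red_church_app_app (n : ℕ) :
    Red (app (app (church n) (var 1)) (var 0)) (iterApp (var 0) n (var 1)) := by
  have hx : (lam (iterApp (var 0) n (var 1))).inst (var 1) = lam (iterApp (var 0) n (var 2)) := by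
    rw [inst, subst, subst_iterApp]
    rfl
  have hf : (iterApp (var 0) n (var 2)).inst (var 0) = iterApp (var 0) n (var 1) := by
    rw [inst, subst_iterApp]
    rfl
  exact ((hx ▸ red_beta _ _ : Red _ _).app_left _).trans (hf ▸ red_beta _ _)

theorem red_succTerm_church (n : ℕ) : Red (app succTerm (church n)) (church (n + 1)) := by
  have hinst : (lam (lam (app (var 0) (app (app (var 2) (var 1)) (var 0))))).inst (church n) =
      lam (lam (app (var 0) (app (app (church n) (var 1)) (var 0)))) := by
    simp only [inst, subst, liftSubst, shiftLam_church]
    rfl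
  refine (hinst ▸ red_beta _ _ : Red _ _).trans (Red.lam (Red.lam ?_))
  rw [iterApp_succ]
  exact Red.app_right _ (red_church_app_app n)

theorem red_iterApp_succTerm (n : ℕ) : Red (iterApp succTerm n (church 0)) (church n) := by
  induction n with
  | zero => exact .refl
  | succ n ih =>
    rw [iterApp_succ]
    exact (Red.app_right _ ih).trans (red_succTerm_church n)

theorem red_idTerm (t : LMTerm) : Red (app idTerm t) t := red_beta (var 0) t

/-! ### The storage operators -/

/-- The continuation `λz (k)(s)z`: the argument that `T₁` hands on increments the integer before it
passes it to `k`. -/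
def contSucc (k : LMTerm) : LMTerm := lam (app k.shiftLam (app succTerm (var 0)))

theorem headStep_contSucc (k t : LMTerm) :
    HeadStep (app (contSucc k) t) (app k (app succTerm t)) := by
  have h : (app k.shiftLam (app succTerm (var 0))).inst t = app k (app succTerm t) :=
    congrArg₂ app (inst_shiftLam k t) rfl
  exact h ▸ headStep_beta _ t

theorem headRed_contSucc_iterate (f : LMTerm) (i j : ℕ) :
    HeadRed (app (contSucc^[j] f) (iterApp succTerm i (church 0)))
      (app f (iterApp succTerm (i + j) (church 0))) := by
  induction j generalizing i with
  | zero => exact .refl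
  | succ j ih =>
    rw [Function.iterate_succ_apply', Nat.add_left_comm, Nat.add_comm j]
    refine .head (headStep_contSucc _ _) ?_
    rw [← iterApp_succ]
    exact ih (i + 1)

theorem isIncrement_contSucc (f : LMTerm) :
    IsIncrement (lam (app (var 1) (app succTerm (var 0)))) fun j => contSucc^[j] f where
  subst_liftSubst _ := rfl
  shiftMu_eq := rfl
  inst_eq _ := (Function.iterate_succ_apply' _ _ _).symm

theorem isIncrement_iterApp_succTerm (t : LMTerm) :
    IsIncrement (app succTerm (var 0)) fun j => iterApp succTerm j t where
  subst_liftSubst _ := rfl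
  shiftMu_eq := rfl
  inst_eq _ := (iterApp_succ _ _ _).symm

theorem headRed_storage1 {u : IntBody} (hu : u.MuClosed) (f : LMTerm) :
    HeadRed (app (app storage1 (lam (lam u.toTerm))) f)
      (app f (iterApp succTerm (u.eval (fun _ => 0) 0) (church 0))) := by
  have hcount := headRed_contSucc_iterate f 0 (u.eval (fun _ => 0) 0)
  rw [Nat.zero_add] at hcount
  exact .head ((headStep_beta _ _).app_app f)
    (((isIncrement_contSucc f).headRed_integer hu deltaTerm).trans
      (.head (headStep_beta _ _) hcount))

theorem headRed_storage2 {u : IntBody} (hu : u.MuClosed) (f : LMTerm) :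
    HeadRed (app (app storage2 (lam (lam u.toTerm))) f)
      (app f (iterApp succTerm (u.eval (fun _ => 0) 0) (church 0))) := by
  have hinst : (app (app (app (lam (lam u.toTerm)).shiftLam (var 0)) fTerm) (church 0)).inst f =
      app (app (app (lam (lam u.toTerm)) f) fTerm) (church 0) :=
    congrArg₂ app (congrArg₂ app (congrArg₂ app (inst_shiftLam _ f) rfl) rfl) rfl
  exact .head ((headStep_beta _ _).app_app f) (.head (hinst ▸ headStep_beta _ f)
    ((isIncrement_iterApp_succTerm (church 0)).headRed_integer hu f))

theorem headRed_storage {T : LMTerm} (hT : T = storage1 ∨ T = storage2) {u : IntBody}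
    (hu : u.MuClosed) (f : LMTerm) :
    HeadRed (app (app T (lam (lam u.toTerm))) f)
      (app f (iterApp succTerm (u.eval (fun _ => 0) 0) (church 0))) := by
  obtain rfl | rfl := hT
  exacts [headRed_storage1 hu f, headRed_storage2 hu f]

end LMTerm

theorem mainTheorem8_general {L : FirstOrder.Language.{u, v}} {zero : L.Functions 0}
    {succ : L.Functions 1} {E : Set (L.Term ℕ × L.Term ℕ)} {n : ℕ} {θ : LMTerm}
    (hθ : IsClassicalInteger zero succ E n θ) (hnormal : θ.Normal) :
    ∃ m, EqConseq E (numeral zero succ m) (numeral zero succ n) ∧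
      ∀ T, T = storage1 ∨ T = storage2 → ∀ f,
        HeadRed (app (app T θ) f) (app f (iterApp succTerm m (church 0))) := by
  obtain ⟨u, rfl, hu, hm⟩ := exists_eq_lam_lam_of_run hnormal hθ.1 (hθ.run _ _)
  exact ⟨_, hm, fun T hT f => headRed_storage hT hu f⟩

theorem mainTheorem8 {L : FirstOrder.Language.{u, v}} (zero : L.Functions 0)
    (succ : L.Functions 1) (E : Set (L.Term ℕ × L.Term ℕ)) (hE : Adequate zero succ E)
    (n : ℕ) (θ : LMTerm) (hθ : IsClassicalInteger zero succ E n θ) (hnormal : θ.Normal)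
    (T : LMTerm) (hT : T = LMTerm.storage1 ∨ T = LMTerm.storage2) :
    (∀ f : ℕ, LMTerm.HeadRed (.app (.app T θ) (.var f))
      (.app (.var f) (LMTerm.iterApp LMTerm.succTerm n (LMTerm.church 0)))) ∧
    LMTerm.HeadRed (.app (.app T θ) LMTerm.idTerm)
      (.app LMTerm.idTerm (LMTerm.iterApp LMTerm.succTerm n (LMTerm.church 0))) ∧
    LMTerm.Red (.app LMTerm.idTerm (LMTerm.iterApp LMTerm.succTerm n (LMTerm.church 0)))
      (LMTerm.church n) ∧
    LMTerm.Red (.app (.app T θ) LMTerm.idTerm) (LMTerm.church n) := by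
  obtain ⟨m, hm, hred⟩ := mainTheorem8_general hθ hnormal
  obtain rfl := hE.eq_of_numeral hm
  have hid := (red_idTerm _).trans (red_iterApp_succTerm m)
  exact ⟨fun f => hred T hT (.var f), hred T hT _, hid, (hred T hT _).red.trans hid⟩
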